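/- Let $D=\{(x,y)\in\mathbb C^2:\operatorname{Im}(x\bar y)>0\}$ and $G=\mathbb C^*\cdot \mathrm{SL}(2,\mathbb R)\subset \mathrm{GL}(2,\mathbb C)$, acting linearly on $D$. Let $\Gamma\subset G$ be a discrete subgroup acting freely and properly on $D$ with compact quotient $X=D/\Gamma$. (By Belgun, every minimal properly elliptic surface with odd first Betti number is of this form.) Endow $X$ with Belgun's Vaisman metric, i.e. with the lcK form $\omega$ induced by the $\Gamma$-invariant form $\tfrac12\operatorname{Im}(x\bar y)\,dd^c\big(\operatorname{Im}(x\bar y)^{-1}\big)$ on $D$, where $dd^c=\sqrt{-1}\,\partial\bar\partial$; its Kähler covering is $(D,\tilde\omega)$ with $\tilde\omega=\tfrac{\sqrt{-1}}2\partial\bar\partial\big(\operatorname{Im}(x\bar y)^{-1}\big)$. For $N\in\mathbb N\cup\{\infty\}$ and $\lambda\in\mathbb C\setminus\{0\}$ with $|\lambda|\ne1$, let $H^N_\lambda=(\mathbb C^N\setminus\{0\})/\langle\lambda\cdot\mathrm{id}\rangle$ be the classical Hopf manifold (with $\mathbb C^\infty:=\ell^2(\mathbb C)$), with the lcK form $\omega_H$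 induced by $\|z\|^{-2}\omega_0$, where $\omega_0=\tfrac{\sqrt{-1}}2\sum_j dz_j\wedge d\bar z_j$ is the flat Kähler form. Then: 1. For all $N\in\mathbb N\cup\{\infty\}$ and all $\lambda$, there is no lcK immersion of $(X,\omega)$ into $H^N_\lambda$, that is, no holomorphic map $f\colon X\to H^N_\lambda$ with $f^*\omega_H=\omega$. (In particular there is no lcK embedding.) 2. Let $\psi\colon D\to \ell^2(\mathbb C)$ be any Kähler immersion, that is, a holomorphic map with $\psi^*\omega_0=\tilde\omega$. Then $\psi$ is not equivariant under $\Gamma$ with respect to any action by scalars on $\ell^2(\mathbb C)$: there is no function $\chi\colon\Gamma\to\mathbb C$ with $\psi(\gamma z)=\chi(\gamma)\,\psi(z)$ for all $\gamma\in\Gamma$ and $z\in D$. Moreover $\psi$ is not invariant under any non-trivial scalar element of $\Gamma$: if $\gamma=c\cdot\mathrm{Id}\in\Gamma$ with $c\neq1$, then $\psi(\gamma z)\neq\psi(z)$ for some $z\in D$. -/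

import Mathlib

open scoped Manifold ContDiff Topology ComplexConjugate
open TopologicalSpace


noncomputable section

namespace LcK

/-! ### Real bilinear forms on complex manifolds, pull-back, the operator `dd^c` -/

section Forms

variable {E : Type*} [NormedAddCommGroup E] [NormedSpace ℂ E]
  {E' : Type*} [NormedAddCommGroup E'] [NormedSpace ℂ E']

/-- A field of real bilinear forms on the tangent spaces of a complex manifold `M` modelled
on `E` (all the fields used below are real two-forms). In Mathlib the tangent space of `M` at `x`
is the vector space `E`, viewed through the preferred chart at `x`. -/
abbrev FormField (E : Type*) [NormedAddCommGroup E] [NormedSpace ℂ E] (M : Type*) :=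
  M → LinearMap.BilinForm ℝ E

variable {M : Type*} [TopologicalSpace M] [ChartedSpace E M]
  {M' : Type*} [TopologicalSpace M'] [ChartedSpace E' M']

/-- The differential `T_x M → T_{f x} M'` of a holomorphic map `f`. -/
def differential (f : M → M') (x : M) : E →L[ℂ] E' :=
  mfderiv 𝓘(ℂ, E) 𝓘(ℂ, E') f x

/-- The pull-back of a bilinear form along a complex linear map. -/
def pullForm (L : E →L[ℂ] E') (B : LinearMap.BilinForm ℝ E') : LinearMap.BilinForm ℝ E :=
  B.compl₁₂ ((L : E →ₗ[ℂ] E').restrictScalars ℝ) ((L : E →ₗ[ℂ] E').restrictScalars ℝ)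

/-- The pull-back `f^* η` of a form along a holomorphic map. -/
def pullback (f : M → M') (η : FormField E' M') : FormField E M := fun x =>
  pullForm (differential f x) (η (f x))

/-- `f` is holomorphic (complex analytic) and satisfies `f^* η' = η`. -/
structure IsHolomorphicIsometry (η : FormField E M) (η' : FormField E' M') (f : M → M') :
    Prop where
  holomorphic : ContMDiff 𝓘(ℂ, E) 𝓘(ℂ, E') (ω : WithTop ℕ∞) f
  pullback_eq : pullback f η' = η

end Forms

section Ddc

variable {E : Type*} [NormedAddCommGroup E] [NormedSpace ℂ E]

/-- Multiplication by `√-1`, as a real linear map. -/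
def cplx (E : Type*) [NormedAddCommGroup E] [NormedSpace ℂ E] : E →L[ℝ] E :=
  (Complex.I • ContinuousLinearMap.id ℂ E).restrictScalars ℝ

/-- The real one-form `d^c u = (√-1/2) (∂̄ - ∂) u`, that is `v ↦ - du (√-1 v) / 2`. -/
def dc (u : E → ℝ) (x : E) : E →L[ℝ] ℝ := (-(1 / 2) : ℝ) • (fderiv ℝ u x).comp (cplx E)

/-- The real two-form `dd^c u = √-1 ∂∂̄ u`: the exterior derivative
`(v, w) ↦ D_v (d^c u) (w) - D_w (d^c u) (v)` of the one-form `d^c u`. -/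
def ddc (u : E → ℝ) : FormField E E := fun x =>
  LinearMap.mk₂ ℝ (fun v w => fderiv ℝ (dc u) x v w - fderiv ℝ (dc u) x w v)
    (by intros; simp; ring) (by intros; simp; ring) (by intros; simp; ring)
    (by intros; simp; ring)

/-- `dd^c` commutes with pull-back along linear isomorphisms. -/
lemma pullForm_ddc (u : E → ℝ) (L : E ≃L[ℂ] E) (x : E) :
    pullForm (L : E →L[ℂ] E) (ddc u (L x)) = ddc (fun z => u (L z)) x := by
  let R : E ≃L[ℝ] E := L.restrictScalars ℝ
  let P : (E →L[ℝ] ℝ) ≃L[ℝ] (E →L[ℝ] ℝ) := R.symm.arrowCongr (ContinuousLinearEquiv.refl ℝ ℝ)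
  have hR : ∀ v, R v = L v := fun _ => rfl
  have hP : ∀ f v, P f v = f (L v) := fun _ _ => rfl
  have h1 : dc (fun z => u (L z)) = fun z => P (dc u (R z)) := by
    funext z
    ext v
    have : fderiv ℝ (fun z => u (L z)) z = (fderiv ℝ u (R z)).comp (R : E →L[ℝ] E) :=
      R.comp_right_fderiv (f := u) (x := z)
    simp [dc, this, hP, hR, cplx]
  have h2 : ∀ v w, fderiv ℝ (dc (fun z => u (L z))) x v w = fderiv ℝ (dc u) (L x) (L v) (L w) := by
    intro v w
    have h3 : fderiv ℝ (fun z => P (dc u (R z))) x =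
        (P : (E →L[ℝ] ℝ) →L[ℝ] (E →L[ℝ] ℝ)).comp (fderiv ℝ (fun z => dc u (R z)) x) :=
      P.comp_fderiv (f := fun z => dc u (R z)) (x := x)
    have h4 : fderiv ℝ (fun z => dc u (R z)) x = (fderiv ℝ (dc u) (R x)).comp (R : E →L[ℝ] E) :=
      R.comp_right_fderiv (f := dc u) (x := x)
    rw [h1, h3, h4]
    simp [hP, hR]
  refine LinearMap.ext fun v => LinearMap.ext fun w => ?_
  simp [pullForm, ddc, h2]

lemma ddc_const_mul (u : E → ℝ) (a : ℝ) (x : E) : ddc (fun z => a * u z) x = a • ddc u x := by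
  have h1 : dc (fun z => a * u z) = a • dc u := by
    funext z
    have : fderiv ℝ (fun z => a * u z) z = a • fderiv ℝ u z :=
      congrFun (fderiv_const_smul_field (f := u) a) z
    ext v
    simp [dc, this]
    ring
  have h2 : fderiv ℝ (dc (fun z => a * u z)) x = a • fderiv ℝ (dc u) x := by
    rw [h1]; exact congrFun (fderiv_const_smul_field (f := dc u) a) x
  refine LinearMap.ext fun v => LinearMap.ext fun w => ?_
  simp [ddc, h2]
  ring

end Ddc

/-- The flat Kähler form `ω₀ = (√-1/2) ∑ dz_j ∧ dz̄_j = (1/2) dd^c ‖z‖²` of a complex Hilbert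
space, that is `ω₀ (v, w) = Re ⟨√-1 v, w⟩`, which is `Im ⟨v, w⟩` for an inner product that is
conjugate linear in the first variable. -/
def flatForm (E : Type*) [NormedAddCommGroup E] [InnerProductSpace ℂ E] : FormField E E :=
  fun _ => LinearMap.mk₂ ℝ (fun v w => (inner ℂ v w).im)
    (by intros; simp)
    (by intro c v w; simp [← Complex.coe_smul, mul_comm])
    (by intros; simp)
    (by intro c v w; simp [← Complex.coe_smul, mul_comm])

/-! ### Quotients of open sets by free, properly discontinuous linear actions -/

section Quotients

variable {E : Type*} [NormedAddCommGroup E] [NormedSpace ℂ E]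

/-- The group `Γ` acts on the open set `Ω` by restrictions of complex linear maps, and each point
of `Ω` has a neighbourhood that is disjoint from its translates. -/
class LinearCoveringAction (Γ : Type*) [Group Γ] (Ω : Opens E) [MulAction Γ Ω] : Prop where
  exists_linear : ∀ g : Γ, ∃ L : E →L[ℂ] E, ∀ x : Ω, ((g • x : Ω) : E) = L x
  wandering : ∀ x : Ω, ∃ U ∈ 𝓝 x, ∀ g : Γ, ((g • ·) '' U ∩ U).Nonempty → g = 1

/-- The orbit space `Ω / Γ`. -/
abbrev OrbitSpace (Γ : Type*) [Group Γ] (Ω : Opens E) [MulAction Γ Ω] : Type _ :=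
  Quotient (MulAction.orbitRel Γ Ω)

variable {Γ : Type*} [Group Γ] {Ω : Opens E} [MulAction Γ Ω]

/-- The projection `Ω → Ω / Γ`. -/
def proj (Γ : Type*) [Group Γ] (Ω : Opens E) [MulAction Γ Ω] (x : Ω) : OrbitSpace Γ Ω :=
  Quotient.mk _ x

lemma proj_out (p : OrbitSpace Γ Ω) : proj Γ Ω p.out = p := Quotient.out_eq p

lemma proj_eq_iff {x y : Ω} : proj Γ Ω x = proj Γ Ω y ↔ ∃ g : Γ, g • y = x := Quotient.eq''

variable (Γ Ω) [LinearCoveringAction Γ Ω]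

lemma isQuotientCoveringMap_proj : IsQuotientCoveringMap (proj Γ Ω) Γ where
  __ : Topology.IsQuotientMap (proj Γ Ω) := isQuotientMap_quotient_mk'
  continuous_const_smul g := by
    obtain ⟨L, hL⟩ := LinearCoveringAction.exists_linear (Ω := Ω) g
    refine continuous_induced_rng.2 ?_
    have : ((↑) ∘ fun x : Ω => g • x) = fun x : Ω => L (x : E) := funext hL
    rw [this]
    exact L.continuous.comp continuous_subtype_val
  apply_eq_iff_mem_orbit := Quotient.eq''
  disjoint := LinearCoveringAction.wandering

lemma isLocalHomeomorph_proj : IsLocalHomeomorph (proj Γ Ω) :=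
  (isQuotientCoveringMap_proj Γ Ω).isCoveringMap.isLocalHomeomorph

variable {Γ Ω}

/-- A local homeomorphism which is a restriction of the projection, defined near the chosen
representative of `p`. -/
def sheet (p : OrbitSpace Γ Ω) : OpenPartialHomeomorph Ω (OrbitSpace Γ Ω) :=
  (isLocalHomeomorph_proj Γ Ω p.out).choose

lemma out_mem_sheet (p : OrbitSpace Γ Ω) : p.out ∈ (sheet p).source :=
  (isLocalHomeomorph_proj Γ Ω p.out).choose_spec.1

lemma coe_sheet (p : OrbitSpace Γ Ω) : ⇑(sheet p) = proj Γ Ω :=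
  (isLocalHomeomorph_proj Γ Ω p.out).choose_spec.2.symm

/-- The chart of `Ω / Γ` at `p`: a local section of the projection through the chosen
representative of `p`, followed by the inclusion of `Ω` in `E`. -/
def quotChart (p : OrbitSpace Γ Ω) : OpenPartialHomeomorph (OrbitSpace Γ Ω) E :=
  (sheet p).symm.trans (Ω.openPartialHomeomorphSubtypeCoe ⟨p.out⟩)

instance : ChartedSpace E (OrbitSpace Γ Ω) where
  atlas := Set.range quotChart
  chartAt := quotChart
  mem_chart_source p := by
    have h := (sheet p).map_source (out_mem_sheet p)
    rw [coe_sheet, proj_out] at h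
    simpa [quotChart] using h
  chart_mem_atlas p := ⟨p, rfl⟩

lemma chartAt_eq (p : OrbitSpace Γ Ω) : chartAt E p = quotChart p := rfl

/-- A local section of the projection, composed with the projection, is locally a translation. -/
lemma sheet_symm_proj (p : OrbitSpace Γ Ω) {x : Ω} (hx : proj Γ Ω x ∈ (sheet p).target) :
    ∃ g : Γ, ∀ᶠ y in 𝓝 x, (sheet p).symm (proj Γ Ω y) = g • y := by
  have hq := isQuotientCoveringMap_proj Γ Ω
  have : ContinuousConstSMul Γ Ω := hq.toContinuousConstSMul
  have sec : ∀ q ∈ (sheet p).target, proj Γ Ω ((sheet p).symm q) = q := fun q hq => by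
    rw [← coe_sheet p]; exact (sheet p).right_inv hq
  have hc : ContinuousAt (fun y => (sheet p).symm (proj Γ Ω y)) x :=
    ((sheet p).continuousAt_symm hx).comp hq.continuous.continuousAt
  obtain ⟨g, hg⟩ := proj_eq_iff.1 (sec _ hx)
  obtain ⟨U, hU, hd⟩ := LinearCoveringAction.wandering (Γ := Γ) ((sheet p).symm (proj Γ Ω x))
  have hg' : ContinuousAt (fun y : Ω => g • y) x := (continuous_const_smul g).continuousAt
  refine ⟨g, ?_⟩
  filter_upwards [hc hU, hg' (show U ∈ 𝓝 (g • x) by rw [hg]; exact hU),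
    hq.continuous.continuousAt ((sheet p).open_target.mem_nhds hx)] with y h1 h2 h3
  obtain ⟨k, hk⟩ := proj_eq_iff.1 ((sec _ h3).trans (hq.map_smul g).symm)
  have := hd k ⟨_, ⟨g • y, h2, hk⟩, h1⟩
  simpa [this] using hk.symm

/-- In the charts of `Ω / Γ`, the projection is locally the restriction of a linear map. -/
lemma quotChart_proj (p : OrbitSpace Γ Ω) {x : Ω} (hx : proj Γ Ω x ∈ (quotChart p).source) :
    ∃ (g : Γ) (L : E →L[ℂ] E), (∀ y : Ω, ((g • y : Ω) : E) = L y) ∧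
      ∀ᶠ y in 𝓝 x, quotChart p (proj Γ Ω y) = L (y : E) := by
  have hx' : proj Γ Ω x ∈ (sheet p).target := by simpa [quotChart] using hx
  obtain ⟨g, hg⟩ := sheet_symm_proj p hx'
  obtain ⟨L, hL⟩ := LinearCoveringAction.exists_linear (Ω := Ω) g
  refine ⟨g, L, hL, hg.mono fun y hy => ?_⟩
  simp [quotChart, hy, hL]

/-- `Ω / Γ` is a complex manifold: the transition maps are locally linear. -/
instance : IsManifold 𝓘(ℂ, E) (ω : WithTop ℕ∞) (OrbitSpace Γ Ω) := by
  refine isManifold_of_contDiffOn _ _ _ ?_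
  rintro _ _ ⟨p, rfl⟩ ⟨p', rfl⟩ z ⟨hz, -⟩
  replace hz : z ∈ ((quotChart p).symm.trans (quotChart p')).source := hz
  refine ContDiffAt.contDiffWithinAt ?_
  have hz1 : z ∈ (quotChart p).target := by
    simpa using ((OpenPartialHomeomorph.trans_source (quotChart p).symm (quotChart p')) ▸ hz).1
  have hz2 : (quotChart p).symm z ∈ (quotChart p').source :=
    ((OpenPartialHomeomorph.trans_source (quotChart p).symm (quotChart p')) ▸ hz).2
  have key : ∀ y ∈ (quotChart p).target, ∃ hy : y ∈ Ω,
      (quotChart p).symm y = proj Γ Ω ⟨y, hy⟩ := by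
    intro y hy
    have hy' := hy
    simp only [quotChart, OpenPartialHomeomorph.trans_target,
      Opens.openPartialHomeomorphSubtypeCoe_target] at hy'
    refine ⟨hy'.1, ?_⟩
    have h3 : (Ω.openPartialHomeomorphSubtypeCoe ⟨p.out⟩).symm y = ⟨y, hy'.1⟩ := by
      apply Subtype.ext
      exact (Ω.openPartialHomeomorphSubtypeCoe ⟨p.out⟩).right_inv (by simpa using hy'.1)
    simp [quotChart, h3, coe_sheet]
  obtain ⟨hzΩ, hz3⟩ := key z hz1
  rw [hz3] at hz2
  obtain ⟨g, L, -, hL⟩ := quotChart_proj p' hz2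
  have hL' : ∀ᶠ y in 𝓝 z, ∀ hy : y ∈ Ω, quotChart p' (proj Γ Ω ⟨y, hy⟩) = L y := by
    rw [← map_nhds_subtype_coe_eq_nhds hzΩ (Ω.isOpen.mem_nhds hzΩ), Filter.eventually_map]
    exact hL.mono fun y hy _ => hy
  refine L.contDiff.contDiffAt.congr_of_eventuallyEq ?_
  filter_upwards [hL', (quotChart p).open_target.mem_nhds hz1] with y hy hy1
  obtain ⟨hyΩ, hy2⟩ := key y hy1
  have := hy hyΩ
  rw [← hy2] at this
  simpa using this

/-- The form on `Ω / Γ` induced by a form `η` on `Ω ⊆ E`: at `p` it is the pull-back of `η` along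
the chart at `p`, a local holomorphic section of the projection. -/
def descend (η : FormField E E) : FormField E (OrbitSpace Γ Ω) := fun p =>
  pullback (fun q : OrbitSpace Γ Ω => chartAt E p q) η p

/-- The restriction to `Ω` of a form on `E`. -/
def restrict (Ω : Opens E) (η : FormField E E) : FormField E Ω :=
  pullback (fun x : Ω => (x : E)) η

lemma mdifferentiable_proj : MDifferentiable 𝓘(ℂ, E) 𝓘(ℂ, E) (proj Γ Ω) := by
  intro x
  have : IsManifold 𝓘(ℂ, E) 1 (OrbitSpace Γ Ω) := IsManifold.of_le (n := ω) le_top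
  have hx := mem_chart_source E (proj Γ Ω x)
  obtain ⟨g, L, -, hL⟩ := quotChart_proj (proj Γ Ω x) hx
  have h1 : MDifferentiableAt 𝓘(ℂ, E) 𝓘(ℂ, E) (fun y : Ω => L (y : E)) x :=
    L.differentiableAt.mdifferentiableAt.comp x
      ((contMDiff_subtype_val (n := 1)).mdifferentiable one_ne_zero x)
  have h2 : MDifferentiableAt 𝓘(ℂ, E) 𝓘(ℂ, E)
      (fun y => chartAt E (proj Γ Ω x) (proj Γ Ω y)) x := h1.congr_of_eventuallyEq hL
  have h3 := mdifferentiableAt_atlas_symm (I := 𝓘(ℂ, E)) (chart_mem_atlas E (proj Γ Ω x))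
    ((chartAt E (proj Γ Ω x)).map_source hx)
  refine (h3.comp x h2).congr_of_eventuallyEq ?_
  filter_upwards [(isQuotientCoveringMap_proj Γ Ω).continuous.continuousAt
    ((chartAt E (proj Γ Ω x)).open_source.mem_nhds hx)] with y hy
  exact ((chartAt E (proj Γ Ω x)).left_inv hy).symm

/-- If `η` is invariant under `Γ`, then the form induced on `Ω / Γ` pulls back to `η`. -/
lemma pullback_proj_descend {η : FormField E E}
    (hη : ∀ (g : Γ) (L : E →L[ℂ] E), (∀ x : Ω, ((g • x : Ω) : E) = L x) →
      ∀ x : Ω, pullForm L (η (L x)) = η x) :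
    pullback (proj Γ Ω) (descend η : FormField E (OrbitSpace Γ Ω)) = restrict Ω η := by
  funext x
  have : IsManifold 𝓘(ℂ, E) 1 (OrbitSpace Γ Ω) := IsManifold.of_le (n := ω) le_top
  have hx := mem_chart_source E (proj Γ Ω x)
  obtain ⟨g, L, hg, hL⟩ := quotChart_proj (proj Γ Ω x) hx
  have hval : MDifferentiableAt 𝓘(ℂ, E) 𝓘(ℂ, E) (fun y : Ω => (y : E)) x :=
    (contMDiff_subtype_val (n := 1)).mdifferentiable one_ne_zero x
  let c : OrbitSpace Γ Ω → E := fun q => chartAt E (proj Γ Ω x) q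
  let A : E →L[ℂ] E := differential c (proj Γ Ω x)
  let B : E →L[ℂ] E := differential (proj Γ Ω) x
  let V : E →L[ℂ] E := differential (fun y : Ω => (y : E)) x
  have h1 : HasMFDerivAt 𝓘(ℂ, E) 𝓘(ℂ, E) (c ∘ proj Γ Ω) x (A.comp B) :=
    (mdifferentiableAt_atlas (chart_mem_atlas E (proj Γ Ω x)) hx).hasMFDerivAt.comp x
      (mdifferentiable_proj x).hasMFDerivAt
  have h2 : HasMFDerivAt 𝓘(ℂ, E) 𝓘(ℂ, E) (c ∘ proj Γ Ω) x (L.comp V) :=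
    HasMFDerivAt.congr_of_eventuallyEq
      (HasMFDerivAt.comp x L.hasFDerivAt.hasMFDerivAt hval.hasMFDerivAt) hL
  have h3 : A.comp B = L.comp V := hasMFDerivAt_unique h1 h2
  have h4 : c (proj Γ Ω x) = L x := hL.self_of_nhds
  have h5 : pullForm (A.comp B) (η (c (proj Γ Ω x))) = pullForm V (η x) := by
    rw [h3, h4, ← hη g L hg x]
    rfl
  exact h5

end Quotients

/-! ### Classical Hopf manifolds -/

section Hopf

variable (E : Type*) [NormedAddCommGroup E] [InnerProductSpace ℂ E]

/-- `E ∖ {0}`. -/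
def punctured : Opens E := ⟨{0}ᶜ, isOpen_compl_singleton⟩

/-- Multiplication by non-zero scalars on `E ∖ {0}`. -/
instance : MulAction ℂˣ (punctured E) where
  smul c z := ⟨(c : ℂ) • (z : E), smul_ne_zero c.ne_zero z.2⟩
  one_smul z := Subtype.ext (one_smul ℂ (z : E))
  mul_smul c d z := Subtype.ext (mul_smul (c : ℂ) (d : ℂ) (z : E))

/-- A complex number `λ ≠ 0` with `|λ| ≠ 1`. -/
structure HopfFactor where
  val : ℂˣ
  norm_ne_one : ‖(val : ℂ)‖ ≠ 1

instance (l : HopfFactor) : LinearCoveringAction (Subgroup.zpowers l.val) (punctured E) where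
  exists_linear g := ⟨((g : ℂˣ) : ℂ) • ContinuousLinearMap.id ℂ E, fun _ => rfl⟩
  wandering x := by
    set a := Real.log ‖(l.val : ℂ)‖ with ha
    have ha0 : a ≠ 0 :=
      Real.log_ne_zero_of_pos_of_ne_one (norm_pos_iff.2 l.val.ne_zero) l.norm_ne_one
    have hx : ∀ y : punctured E, ‖(y : E)‖ ≠ 0 := fun y => norm_ne_zero_iff.2 y.2
    have hc : Continuous fun y : punctured E => Real.log ‖(y : E)‖ :=
      Continuous.log (by fun_prop) hx
    refine ⟨(fun y : punctured E => Real.log ‖(y : E)‖) ⁻¹'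
      Metric.ball (Real.log ‖(x : E)‖) (|a| / 2),
      hc.continuousAt (Metric.ball_mem_nhds _ (by positivity)), ?_⟩
    rintro ⟨g, n, rfl⟩ ⟨_, ⟨y, hy, rfl⟩, hy'⟩
    have key : Real.log ‖(((⟨l.val ^ n, n, rfl⟩ : Subgroup.zpowers l.val) • y : punctured E) : E)‖
        = n * a + Real.log ‖(y : E)‖ := by
      change Real.log ‖((l.val ^ n : ℂˣ) : ℂ) • (y : E)‖ = _
      rw [norm_smul, Real.log_mul (norm_ne_zero_iff.2 (l.val ^ n).ne_zero) (hx y)]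
      simp [ha, Real.log_zpow]
    simp only [Set.mem_preimage, Metric.mem_ball, Real.dist_eq] at hy hy'
    rw [key] at hy'
    have h1 : |(n : ℝ) * a| < |a| := by
      have := abs_sub (n * a + Real.log ‖(y : E)‖ - Real.log ‖(x : E)‖)
        (Real.log ‖(y : E)‖ - Real.log ‖(x : E)‖)
      have h2 : n * a + Real.log ‖(y : E)‖ - Real.log ‖(x : E)‖ -
        (Real.log ‖(y : E)‖ - Real.log ‖(x : E)‖) = n * a := by ring
      rw [h2] at this
      linarith
    rw [abs_mul] at h1
    have h3 : |(n : ℝ)| < 1 := by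
      by_contra h
      push Not at h
      nlinarith [abs_nonneg a]
    have h4 : n = 0 := by
      rw [← Int.abs_lt_one_iff]
      exact_mod_cast h3
    subst h4
    simp

/-- The classical Hopf manifold `(E ∖ {0}) / ⟨λ · id⟩`. -/
abbrev Hopf (l : HopfFactor) : Type _ := OrbitSpace (Subgroup.zpowers l.val) (punctured E)

/-- The lcK form of the classical Hopf manifold, induced by `‖z‖⁻² ω₀` on `E ∖ {0}`. -/
def hopfForm (l : HopfFactor) : FormField E (Hopf E l) :=
  descend fun z => (‖z‖ ^ 2)⁻¹ • flatForm E z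

/-- The form `‖z‖⁻² ω₀` is invariant, so that `hopfForm` pulls back to it. -/
lemma pullback_hopfForm (l : HopfFactor) :
    pullback (proj (Subgroup.zpowers l.val) (punctured E)) (hopfForm E l) =
      restrict (punctured E) fun z => (‖z‖ ^ 2)⁻¹ • flatForm E z := by
  refine pullback_proj_descend fun g L hL x => ?_
  have hLv : ∀ v, L v = ((g : ℂˣ) : ℂ) • v := by
    intro v
    by_cases h : v = 0
    · simp [h]
    · exact (hL ⟨v, h⟩).symm
  have h1 : ‖((g : ℂˣ) : ℂ)‖ ≠ 0 := norm_ne_zero_iff.2 (g : ℂˣ).ne_zero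
  have h2 : ∀ v w : E, (inner ℂ (((g : ℂˣ) : ℂ) • v) (((g : ℂˣ) : ℂ) • w)).im =
      ‖((g : ℂˣ) : ℂ)‖ ^ 2 * (inner ℂ v w).im := by
    intro v w
    rw [inner_smul_left, inner_smul_right, ← mul_assoc, mul_comm (conj _), Complex.mul_conj,
      Complex.normSq_eq_norm_sq, Complex.im_ofReal_mul]
  refine LinearMap.ext fun v => LinearMap.ext fun w => ?_
  have h3 : ‖(x : E)‖ ≠ 0 := norm_ne_zero_iff.2 x.2
  change (‖L x‖ ^ 2)⁻¹ * (inner ℂ (L v) (L w)).im = (‖(x : E)‖ ^ 2)⁻¹ * (inner ℂ v w).im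
  rw [hLv, hLv, hLv, h2, norm_smul]
  field_simp

end Hopf

/-! ### Quotients of `D = {(x, y) ∈ ℂ² : Im (x ȳ) > 0}` -/

section Elliptic

/-- The function `(x, y) ↦ Im (x ȳ)` on `ℂ²`. -/
def imProd (z : Fin 2 → ℂ) : ℝ := (z 0 * conj (z 1)).im

lemma continuous_imProd : Continuous imProd := by
  unfold imProd
  fun_prop

/-- The domain `D` of `ℂ²`. -/
def D : Opens (Fin 2 → ℂ) := ⟨{z | 0 < imProd z}, isOpen_lt continuous_const continuous_imProd⟩

/-- The Kähler form `ω̃ = (1/2) dd^c Φ = (√-1/2) ∂∂̄ Φ` with potential `Φ = Im (x ȳ)⁻¹`. -/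
def kahlerForm : FormField (Fin 2 → ℂ) (Fin 2 → ℂ) := fun z =>
  (1 / 2 : ℝ) • ddc (fun z => (imProd z)⁻¹) z

open Matrix in
/-- The subgroup `G = ℂ^* · SL(2, ℝ)` of `GL(2, ℂ)`. -/
def G : Subgroup (GL (Fin 2) ℂ) where
  carrier := {g | ∃ (c : ℂˣ) (A : SpecialLinearGroup (Fin 2) ℝ),
    g = GeneralLinearGroup.scalar (Fin 2) c * SpecialLinearGroup.mapGL ℂ A}
  mul_mem' := by
    rintro _ _ ⟨c, A, rfl⟩ ⟨d, B, rfl⟩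
    refine ⟨c * d, A * B, ?_⟩
    rw [map_mul, map_mul, mul_assoc, ← mul_assoc (SpecialLinearGroup.mapGL ℂ A),
      ← GeneralLinearGroup.scalar_commute d (SpecialLinearGroup.mapGL ℂ A)]
    simp only [mul_assoc]
  one_mem' := ⟨1, 1, by simp⟩
  inv_mem' := by
    rintro _ ⟨c, A, rfl⟩
    refine ⟨c⁻¹, A⁻¹, ?_⟩
    rw [_root_.mul_inv_rev, map_inv, map_inv, ← map_inv, ← map_inv]
    exact (GeneralLinearGroup.scalar_commute _ _).symm

open Matrix in
/-- `Im (x ȳ)` is multiplied by `|c|²` under `c · A`. -/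
lemma exists_imProd_mulVec (g : G) :
    ∃ c : ℂˣ, ∀ z : Fin 2 → ℂ,
      imProd ((g : GL (Fin 2) ℂ).val *ᵥ z) = ‖(c : ℂ)‖ ^ 2 * imProd z := by
  obtain ⟨_, c, A, rfl⟩ := g
  refine ⟨c, fun z => ?_⟩
  have hA : A.1 0 0 * A.1 1 1 - A.1 0 1 * A.1 1 0 = 1 := by rw [← det_fin_two]; exact A.2
  have hn : ‖(c : ℂ)‖ ^ 2 = (c : ℂ).re ^ 2 + (c : ℂ).im ^ 2 := by
    rw [Complex.sq_norm, Complex.normSq_apply]; ring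
  have h : ∀ i, ((GeneralLinearGroup.scalar (Fin 2) c *
      SpecialLinearGroup.mapGL ℂ A : GL (Fin 2) ℂ).val *ᵥ z) i
      = c * ((A.1 i 0 : ℂ) * z 0 + (A.1 i 1 : ℂ) * z 1) := by
    intro i
    simp [mulVec, dotProduct, Fin.sum_univ_two, GeneralLinearGroup.coe_scalar, scalar_apply]
    ring
  simp only [imProd, h, hn]
  simp [Complex.mul_re, Complex.mul_im, Complex.add_re, Complex.add_im]
  linear_combination ((c : ℂ).re ^ 2 + (c : ℂ).im ^ 2) *
    ((z 0).im * (z 1).re - (z 0).re * (z 1).im) * hA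

open Matrix in
/-- The linear action of `G` on `D`. -/
instance : MulAction G D where
  smul g z := ⟨(g : GL (Fin 2) ℂ).val *ᵥ (z : Fin 2 → ℂ), by
    obtain ⟨c, hc⟩ := exists_imProd_mulVec g
    change 0 < imProd _
    rw [hc]
    exact mul_pos (by have := c.ne_zero; positivity) z.2⟩
  one_smul z := Subtype.ext (one_mulVec (z : Fin 2 → ℂ))
  mul_smul g h z := Subtype.ext (mulVec_mulVec (z : Fin 2 → ℂ) g.1.val h.1.val).symm

variable (Γ : Subgroup G) [DiscreteTopology Γ] [ProperSMul Γ D] [IsCancelSMul Γ D]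

instance : LinearCoveringAction Γ D where
  exists_linear g :=
    ⟨(Matrix.mulVecLin (g : G).1.val).toContinuousLinearMap, fun _ => rfl⟩
  wandering x := by
    have : LocallyCompactSpace D := D.isOpen.locallyCompactSpace
    have : ContinuousSMul Γ D := ProperSMul.toContinuousSMul
    have : ContinuousConstSMul Γ D := ContinuousSMul.continuousConstSMul
    have : ProperlyDiscontinuousSMul Γ D :=
      properlyDiscontinuousSMul_iff_properSMul.2 inferInstance
    exact (isQuotientCoveringMap_quotientMk_of_properlyDiscontinuousSMul (G := Γ) (E := D)).disjoint x

/-- The complex surface `D / Γ`, for a discrete subgroup `Γ` of `G` acting freely and properly. -/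
abbrev Surface : Type := OrbitSpace Γ D

/-- Belgun's lcK form on `D / Γ`, induced by `(1/2) Im (x ȳ) dd^c (Im (x ȳ)⁻¹)` on `D`. -/
def belgunForm : FormField (Fin 2 → ℂ) (Surface Γ) :=
  descend fun z => imProd z • kahlerForm z

/-- The form `(1/2) Im (x ȳ) dd^c (Im (x ȳ)⁻¹)` is invariant, so that `belgunForm` pulls back
to it. -/
lemma pullback_belgunForm :
    pullback (proj Γ D) (belgunForm Γ) = restrict D fun z => imProd z • kahlerForm z := by
  refine pullback_proj_descend fun g L hL x => ?_
  obtain ⟨c, hc⟩ := exists_imProd_mulVec (g : G)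
  have hc0 : ‖(c : ℂ)‖ ^ 2 ≠ 0 := pow_ne_zero 2 (norm_ne_zero_iff.2 c.ne_zero)
  let M : (Fin 2 → ℂ) ≃L[ℂ] (Fin 2 → ℂ) := ContinuousLinearEquiv.equivOfInverse
    (Matrix.mulVecLin (g : G).1.val).toContinuousLinearMap
    (Matrix.mulVecLin (g : G).1⁻¹.val).toContinuousLinearMap
    (fun z => by
      change (g : G).1⁻¹.val.mulVec ((g : G).1.val.mulVec z) = z
      rw [Matrix.mulVec_mulVec, ← Units.val_mul, inv_mul_cancel, Units.val_one, Matrix.one_mulVec])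
    (fun z => by
      change (g : G).1.val.mulVec ((g : G).1⁻¹.val.mulVec z) = z
      rw [Matrix.mulVec_mulVec, ← Units.val_mul, mul_inv_cancel, Units.val_one, Matrix.one_mulVec])
  have hM : ∀ z, imProd (M z) = ‖(c : ℂ)‖ ^ 2 * imProd z := hc
  have hLM : L = M := by
    have h1 : (fun z => L z) =ᶠ[𝓝 (x : Fin 2 → ℂ)] fun z => M z := by
      filter_upwards [D.isOpen.mem_nhds x.2] with z hz
      exact (hL ⟨z, hz⟩).symm
    exact (L.hasFDerivAt (x := (x : Fin 2 → ℂ))).unique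
      ((M : (Fin 2 → ℂ) →L[ℂ] (Fin 2 → ℂ)).hasFDerivAt.congr_of_eventuallyEq h1)
  have h2 : pullForm (M : (Fin 2 → ℂ) →L[ℂ] (Fin 2 → ℂ)) (ddc (fun z => (imProd z)⁻¹) (M x)) =
      (‖(c : ℂ)‖ ^ 2)⁻¹ • ddc (fun z => (imProd z)⁻¹) (x : Fin 2 → ℂ) := by
    rw [pullForm_ddc, ← ddc_const_mul]
    simp only [hM, mul_inv]
  rw [hLM]
  refine LinearMap.ext fun v => LinearMap.ext fun w => ?_
  have h3 : ddc (fun z => (imProd z)⁻¹) (M x) (M v) (M w) =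
      (‖(c : ℂ)‖ ^ 2)⁻¹ * ddc (fun z => (imProd z)⁻¹) (x : Fin 2 → ℂ) v w :=
    congrArg (fun B : LinearMap.BilinForm ℝ (Fin 2 → ℂ) => B v w) h2
  change imProd (M x) * (1 / 2 * ddc (fun z => (imProd z)⁻¹) (M x) (M v) (M w)) =
    imProd x * (1 / 2 * ddc (fun z => (imProd z)⁻¹) (x : Fin 2 → ℂ) v w)
  rw [h3, hM]
  field_simp

end Elliptic

/-- The Hilbert space `l²(ℂ)`. -/
abbrev EllTwo : Type := lp (fun _ : ℕ => ℂ) 2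

end LcK

/-!
The potential of `D` is `1 / h(z, z)` for a nondegenerate Hermitian form `h` on `ℂ²`. For a map
that pulls the flat form back to the Kähler form of this potential, both sides of the isometry
equation are diagonal values of functions antiholomorphic in `q` and holomorphic in `p`, so they
agree off the diagonal.

Let `ψ` be a Kähler immersion. On the radial vectors the polarized equation reads
`⟨dψ_q q, dψ_p p⟩ = 1 / h(q, p)`. If `ψ ∘ γ = χ ψ`, comparing this identity at `p` and at `γ p`
gives `h(q, χ γ p - p) = 0` for all `q`, so `χ γ p = p`.

Let `f` be a local lift of a map to a Hopf manifold. The polarized equation says that the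
differential of `⟨df_q v, f(p)⟩` in `p` is `⟨f(q), f(p)⟩ h(q, p)` times that of
`- h(v, p) / h(q, p)²`. Symmetry of second derivatives forces the factor `⟨f(q), f(p)⟩ h(q, p)` to
be constant in `p`, hence `h` determines the angle between the lines through `f(q)` and `f(p)`. By
analytic continuation this holds on all of `D`, and it shows that points with the same image in
the Hopf manifold lie on one complex line through the origin.

In both cases `Γ` would have to preserve every complex line through the origin, and `Im (x / y)`
would be a continuous unbounded function on the compact quotient.
-/

namespace LcK

section Polarization

variable {V : Type*} [NormedAddCommGroup V] [NormedSpace ℂ V]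
  {E : Type*} [NormedAddCommGroup E] [InnerProductSpace ℂ E]

/-- `T q p` is antiholomorphic in `q` and holomorphic in `p` on `U`, in the weak sense that it is
holomorphic in `t` along every pair of lines `q = a + t̄ b`, `p = m + t n`. -/
def SesquiholomorphicOn (T : V → V → ℂ) (U : Set V) : Prop :=
  ∀ (a b m n : V) (s : ℂ), a + conj s • b ∈ U → m + s • n ∈ U →
    DifferentiableAt ℂ (fun t : ℂ => T (a + conj t • b) (m + t • n)) s

namespace SesquiholomorphicOn

variable {S T : V → V → ℂ} {U : Set V}

protected lemma sub (hS : SesquiholomorphicOn S U) (hT : SesquiholomorphicOn T U) :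
    SesquiholomorphicOn (fun q p => S q p - T q p) U :=
  fun a b m n s hq hp => (hS a b m n s hq hp).sub (hT a b m n s hq hp)

protected lemma mul (hS : SesquiholomorphicOn S U) (hT : SesquiholomorphicOn T U) :
    SesquiholomorphicOn (fun q p => S q p * T q p) U :=
  fun a b m n s hq hp => (hS a b m n s hq hp).mul (hT a b m n s hq hp)

protected lemma pow (hT : SesquiholomorphicOn T U) (k : ℕ) :
    SesquiholomorphicOn (fun q p => T q p ^ k) U :=
  fun a b m n s hq hp => (hT a b m n s hq hp).pow k

end SesquiholomorphicOn

lemma differentiableAt_inner_comp_conj {a b : ℂ → E} {s : ℂ}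
    (ha : DifferentiableAt ℂ a (conj s)) (hb : DifferentiableAt ℂ b s) :
    DifferentiableAt ℂ (fun t : ℂ => inner ℂ (a (conj t)) (b t)) s := by
  have h_conj : HasFDerivAt (fun t : ℂ => a (conj t)) _ s :=
    HasFDerivAt.comp s (ha.hasFDerivAt.restrictScalars ℝ) Complex.conjCLE.hasFDerivAt
  have h_real := h_conj.inner ℂ (hb.hasFDerivAt.restrictScalars ℝ)
  refine (hasFDerivAt_of_restrictScalars ℝ h_real (f' := ContinuousLinearMap.toSpanSingleton ℂ
    (inner ℂ (a (conj s)) (fderiv ℂ b s 1) + inner ℂ (fderiv ℂ a (conj s) 1) (b s))) ?_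
    ).differentiableAt
  refine ContinuousLinearMap.ext fun t => ?_
  have apply_eq_smul : ∀ (L : ℂ →L[ℂ] E) (t : ℂ), L t = t • L 1 := fun L t => by
    rw [← map_smul, smul_eq_mul, mul_one]
  simp only [fderiv_eq_smul_deriv, one_smul, ContinuousLinearMap.coe_restrictScalars',
    ContinuousLinearMap.toSpanSingleton_apply, smul_eq_mul, ContinuousLinearMap.comp_apply,
    ContinuousLinearMap.prod_apply, ContinuousLinearEquiv.coe_coe, ContinuousAlgEquiv.coeCLE_apply,
    Complex.conjCAE_apply, apply_eq_smul _ (conj t), apply_eq_smul _ t, fderivInnerCLM_apply,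
    inner_smul_right, inner_smul_left, RingHomCompTriple.comp_apply, RingHom.id_apply]
  ring

lemma sesquiholomorphicOn_inner {f g : V → E} {U : Set V}
    (hf : ∀ p ∈ U, DifferentiableAt ℂ f p) (hg : ∀ p ∈ U, DifferentiableAt ℂ g p) :
    SesquiholomorphicOn (fun q p => inner ℂ (f q) (g p)) U := by
  intro a b m n s hq hp
  refine differentiableAt_inner_comp_conj (a := fun t => f (a + t • b)) ?_ ?_
  · exact (hf _ hq).comp (conj s) (f := fun t : ℂ => a + t • b) (by fun_prop)
  · exact (hg _ hp).comp s (f := fun t : ℂ => m + t • n) (by fun_prop)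

lemma sesquiholomorphicOn_form (h : V →L⋆[ℂ] V →L[ℂ] ℂ) (U : Set V) :
    SesquiholomorphicOn (fun q p => h q p) U := by
  intro a b m n s _ _
  simp only [map_add, map_smulₛₗ, Complex.conj_conj, add_apply,
    smul_apply, RingHom.id_apply]
  fun_prop

lemma eq_zero_of_forall_real_eq_zero {F : Type*} [NormedAddCommGroup F] [NormedSpace ℂ F]
    [CompleteSpace F] {g : ℂ → F} {W : Set ℂ} (hWo : IsOpen W) (hW : IsPreconnected W)
    (hg : DifferentiableOn ℂ g W) {x : ℝ} (hx : (x : ℂ) ∈ W)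
    (h0 : ∀ t : ℝ, (t : ℂ) ∈ W → g t = 0) {s : ℂ} (hs : s ∈ W) : g s = 0 := by
  have h_tendsto : Filter.Tendsto (fun t : ℝ => (t : ℂ)) (𝓝[≠] x) (𝓝[≠] (x : ℂ)) :=
    Complex.continuous_ofReal.continuousWithinAt.tendsto_nhdsWithin fun t ht =>
      Complex.ofReal_injective.ne ht
  have h_near : ∀ᶠ t : ℝ in 𝓝[≠] x, g t = 0 :=
    (h_tendsto.eventually (nhdsWithin_le_nhds (hWo.mem_nhds hx))).mono h0
  exact (hg.analyticOnNhd hWo).eqOn_zero_of_preconnected_of_frequently_eq_zero hW hx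
    (h_tendsto.frequently h_near.frequently) hs

lemma isOpen_preimage_line {U : Set V} (hU : IsOpen U) (m n : V) :
    IsOpen ((fun t : ℂ => m + t • n) ⁻¹' U) :=
  hU.preimage (by fun_prop)

lemma convex_preimage_line {U : Set V} (hU : Convex ℝ U) (m n : V) :
    Convex ℝ ((fun t : ℂ => m + t • n) ⁻¹' U) :=
  (hU.translate_preimage_right m).linear_preimage
    ((LinearMap.toSpanSingleton ℂ V n).restrictScalars ℝ)

/-- The points `p` and `q` are the values of `s ↦ m + s n` at `I` and at its conjugate, where `m`
is their midpoint; the diagonal corresponds to real `s`. -/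
lemma SesquiholomorphicOn.eq_zero_of_diagonal {T : V → V → ℂ} {U : Set V}
    (hT : SesquiholomorphicOn T U) (hUo : IsOpen U) (hU : Convex ℝ U)
    (h0 : ∀ p ∈ U, T p p = 0) {q p : V} (hq : q ∈ U) (hp : p ∈ U) : T q p = 0 := by
  set m : V := (1 / 2 : ℝ) • q + (1 / 2 : ℝ) • p with hm
  set n : V := (-Complex.I / 2) • (p - q) with hn
  have h_p : m + Complex.I • n = p := by
    rw [hm, hn, smul_smul, show Complex.I * (-Complex.I / 2) = ((1 / 2 : ℝ) : ℂ) by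
      push_cast; linear_combination (-1 / 2 : ℂ) * Complex.I_mul_I, Complex.coe_smul]
    module
  have h_q : m + conj Complex.I • n = q := by
    rw [hm, hn, Complex.conj_I, smul_smul, show -Complex.I * (-Complex.I / 2) = ((-1 / 2 : ℝ) : ℂ)
      by push_cast; linear_combination (1 / 2 : ℂ) * Complex.I_mul_I, Complex.coe_smul]
    module
  let L : Set ℂ := (fun t => m + t • n) ⁻¹' U
  have hL : Convex ℝ L := convex_preimage_line hU m n
  have hLo : IsOpen L := isOpen_preimage_line hUo m n
  have h_zero_mem : (0 : ℂ) ∈ L := by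
    have : m ∈ U := hU hq hp (by norm_num) (by norm_num) (by norm_num)
    simpa [L] using this
  have h_slice := eq_zero_of_forall_real_eq_zero (W := conj ⁻¹' L ∩ L) (x := 0) (s := Complex.I)
    (g := fun t => T (m + conj t • n) (m + t • n))
    ((hLo.preimage Complex.continuous_conj).inter hLo)
    ((hL.linear_preimage Complex.conjAe.toLinearMap).inter hL).isPreconnected
    (fun s hs => (hT m n m n s hs.1 hs.2).differentiableWithinAt)
    (by simpa using h_zero_mem)
    (fun t ht => by rw [Complex.conj_ofReal]; exact h0 _ ht.2)
    ⟨by simpa only [L, Set.mem_preimage, h_q] using hq, by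
      simpa only [L, Set.mem_preimage, h_p] using hp⟩
  simpa only [h_p, h_q] using h_slice

lemma SesquiholomorphicOn.eq_of_diagonal {S T : V → V → ℂ} {U : Set V}
    (hS : SesquiholomorphicOn S U) (hT : SesquiholomorphicOn T U) (hUo : IsOpen U)
    (hU : Convex ℝ U) (h_diag : ∀ p ∈ U, S p p = T p p) {q p : V} (hq : q ∈ U) (hp : p ∈ U) :
    S q p = T q p :=
  sub_eq_zero.1 <| (hS.sub hT).eq_zero_of_diagonal hUo hU
    (fun p hp => sub_eq_zero.2 (h_diag p hp)) hq hp

end Polarization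

section Potential

variable {V : Type*} [NormedAddCommGroup V] [NormedSpace ℂ V] (h : V →L⋆[ℂ] V →L[ℂ] ℂ)

/-- The functional `w ↦ h(q, p)³ ∂_w ∂̄_v (1 / h(q, p))`, where `∂_w` differentiates in `p` and
`∂̄_v` in `q`: the polarized complex Hessian of the potential `1 / h(z, z)`, cleared of
denominators. -/
def potentialHessian (q p v : V) : V →L[ℂ] ℂ := (2 * h v p) • h q - h q p • h v

lemma potentialHessian_apply (q p v w : V) :
    potentialHessian h q p v w = 2 * h v p * h q w - h q p * h v w := rfl

lemma sesquiholomorphicOn_potentialHessian (v w : V) (U : Set V) :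
    SesquiholomorphicOn (fun q p => potentialHessian h q p v w) U := by
  intro a b m n s _ _
  simp only [potentialHessian_apply, map_add, map_smulₛₗ, Complex.conj_conj, add_apply, smul_apply,
    RingHom.id_apply]
  fun_prop

lemma hasFDerivAt_neg_form_div_sq {q p : V} (v : V) (hqp : h q p ≠ 0) :
    HasFDerivAt (fun p => -h v p / h q p ^ 2) ((h q p ^ 3)⁻¹ • potentialHessian h q p v) p := by
  have h_quot := ((h v).hasFDerivAt (x := p)).neg.mul
    ((hasDerivAt_inv (pow_ne_zero 2 hqp)).comp_hasFDerivAt p ((h q).hasFDerivAt.pow 2))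
  refine h_quot.congr_fderiv ?_
  ext w
  simp only [Pi.neg_apply, Nat.add_one_sub_one, pow_one, nsmul_eq_mul, Nat.cast_ofNat,
    Function.comp_apply, smul_neg, add_apply, smul_apply, smul_eq_mul, neg_mul, mul_neg, neg_neg,
    neg_apply, potentialHessian_apply]
  field_simp
  ring

/-- The real part of a sesquilinear form, as a real bilinear map. -/
def formRe : V →L[ℝ] V →L[ℝ] ℝ :=
  LinearMap.mkContinuous₂
    (LinearMap.mk₂ ℝ (fun v w => (h v w).re)
      (by intros; simp)
      (by intro c v w; rw [← Complex.coe_smul, map_smulₛₗ]; simp)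
      (by intros; simp)
      (by intro c v w; rw [← Complex.coe_smul, map_smul]; simp))
    ‖h‖ fun v w => (Complex.abs_re_le_norm _).trans (h.le_opNorm₂ v w)

lemma formRe_apply (v w : V) : formRe h v w = (h v w).re := rfl

variable {h} (h_herm : ∀ p q, conj (h p q) = h q p)
include h_herm

lemma hasFDerivAt_form_self_re (z : V) :
    HasFDerivAt (fun z => (h z z).re) ((2 : ℝ) • formRe h z) z := by
  have h_diag : HasFDerivAt (fun z => formRe h z z) _ z :=
    (formRe h).hasFDerivAt.clm_apply (hasFDerivAt_id z)
  refine h_diag.congr_fderiv (ContinuousLinearMap.ext fun v => ?_)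
  have h_symm : (h v z).re = (h z v).re := by rw [← h_herm z v, Complex.conj_re]
  simp only [ContinuousLinearMap.comp_id, add_apply, formRe_apply, ContinuousLinearMap.flip_apply,
    h_symm, smul_apply, smul_eq_mul]
  ring

lemma dc_inv_form_self {z : V} (hz : (h z z).re ≠ 0) :
    dc (fun z => ((h z z).re)⁻¹) z = ((h z z).re ^ 2)⁻¹ • (formRe h z).comp (cplx V) := by
  have h_inv : HasFDerivAt (fun z => ((h z z).re)⁻¹) _ z :=
    (hasDerivAt_inv hz).comp_hasFDerivAt z (hasFDerivAt_form_self_re h_herm z)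
  ext v
  simp only [dc, h_inv.fderiv, neg_smul, ContinuousLinearMap.neg_comp,
    ContinuousLinearMap.smul_comp, smul_neg, neg_neg, smul_apply, ContinuousLinearMap.comp_apply,
    smul_eq_mul]
  ring

lemma ddc_inv_form_self {z : V} (hz : (h z z).re ≠ 0) (v w : V) :
    ddc (fun z => ((h z z).re)⁻¹) z v w = 2 * (potentialHessian h z z v w).im / (h z z).re ^ 3 := by
  let C : V →L[ℝ] V →L[ℝ] ℝ :=
    ((ContinuousLinearMap.compL ℝ V V ℝ).flip (cplx V)).comp (formRe h)
  have h_cont : ContinuousAt (fun z => (h z z).re) z :=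
    (hasFDerivAt_form_self_re h_herm z).continuousAt
  have h_dc : dc (fun z => ((h z z).re)⁻¹) =ᶠ[𝓝 z] fun x => ((h x x).re ^ 2)⁻¹ • C x :=
    (h_cont.eventually_ne hz).mono fun x hx => dc_inv_form_self h_herm hx
  have h_coeff : HasFDerivAt (fun x => ((h x x).re ^ 2)⁻¹) _ z :=
    (hasDerivAt_inv (pow_ne_zero 2 hz)).comp_hasFDerivAt z
      ((hasFDerivAt_form_self_re h_herm z).pow 2)
  have h_ddc : ddc (fun z => ((h z z).re)⁻¹) z v w =
      fderiv ℝ (dc fun z => ((h z z).re)⁻¹) z v w -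
        fderiv ℝ (dc fun z => ((h z z).re)⁻¹) z w v := rfl
  have hC : ∀ x y, C x y = -(h x y).im := fun x y => by simp [C, formRe_apply, cplx]
  have h_zz : (h z z).im = 0 := Complex.conj_eq_iff_im.1 (h_herm z z)
  have h_re : (h v z).re = (h z v).re := by rw [← h_herm z v, Complex.conj_re]
  have h_im : (h v z).im = -(h z v).im := by rw [← h_herm z v, Complex.conj_im]
  have h_im' : (h w v).im = -(h v w).im := by rw [← h_herm v w, Complex.conj_im]
  rw [h_ddc, ((h_coeff.smul C.hasFDerivAt).congr_of_eventuallyEq h_dc).fderiv]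
  simp only [Nat.add_one_sub_one, pow_one, nsmul_eq_mul, Nat.cast_ofNat, neg_smul, add_apply,
    smul_apply, ContinuousLinearMap.smulRight_apply, neg_apply, formRe_apply, smul_eq_mul, hC,
    mul_neg, neg_neg, h_im', potentialHessian_apply, Complex.sub_im, Complex.mul_im,
    Complex.mul_re, Complex.re_ofNat, h_re, Complex.im_ofNat, h_im, zero_mul, neg_zero, sub_zero,
    add_zero, neg_mul, h_zz]
  field_simp
  ring

end Potential

section Isometry

variable {V : Type*} [NormedAddCommGroup V] [NormedSpace ℂ V] {h : V →L⋆[ℂ] V →L[ℂ] ℂ}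
  {E : Type*} [NormedAddCommGroup E] [InnerProductSpace ℂ E]

/-- The form `(1/2) dd^c (1 / h(z, z))` of a Hermitian form `h`. -/
def reciprocalForm (h : V →L⋆[ℂ] V →L[ℂ] ℂ) : FormField V V := fun z =>
  (1 / 2 : ℝ) • ddc (fun z => ((h z z).re)⁻¹) z

lemma reciprocalForm_apply (h_herm : ∀ p q, conj (h p q) = h q p) {z : V}
    (hz : (h z z).re ≠ 0) (v w : V) :
    reciprocalForm h z v w = (potentialHessian h z z v w).im / (h z z).re ^ 3 := by
  change 1 / 2 * ddc (fun z => ((h z z).re)⁻¹) z v w = _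
  rw [ddc_inv_form_self h_herm hz]
  ring

lemma re_form_self_ne_zero (h_herm : ∀ p q, conj (h p q) = h q p) {z : V} (hz : h z z ≠ 0) :
    (h z z).re ≠ 0 := by
  rwa [← Complex.conj_eq_iff_re.1 (h_herm z z), Complex.ofReal_ne_zero] at hz

lemma clm_eq_of_forall_im_eq {A B : V →L[ℂ] ℂ} (hAB : ∀ v, (A v).im = (B v).im) : A = B := by
  ext v
  refine Complex.ext ?_ (hAB v)
  simpa [map_smul] using hAB (Complex.I • v)

lemma inner_apply_mul_cube {L : V →L[ℂ] E} {z : V} {y : E}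
    (h_herm : ∀ p q, conj (h p q) = h q p) (hz : (h z z).re ≠ 0)
    (hL : pullForm L (flatForm E y) = reciprocalForm h z) (v w : V) :
    inner ℂ (L v) (L w) * h z z ^ 3 = potentialHessian h z z v w := by
  have h_real : ((h z z).re : ℂ) = h z z := Complex.conj_eq_iff_re.1 (h_herm z z)
  have h_clm : (h z z).re ^ 3 • (innerSL ℂ (L v)).comp L = potentialHessian h z z v := by
    refine clm_eq_of_forall_im_eq fun w => ?_
    have h_im : (inner ℂ (L v) (L w)).im = reciprocalForm h z v w :=
      DFunLike.congr_fun (DFunLike.congr_fun hL v) w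
    rw [reciprocalForm_apply h_herm hz] at h_im
    simp only [smul_apply, ContinuousLinearMap.comp_apply, innerSL_apply_apply, Complex.smul_im,
      smul_eq_mul, h_im]
    field_simp
  rw [← h_clm, ← h_real]
  simp [mul_comm]

lemma inner_apply_mul_sq {L : V →L[ℂ] E} {z : V} {y : E}
    (h_herm : ∀ p q, conj (h p q) = h q p) (hz : (h z z).re ≠ 0) (hy : y ≠ 0)
    (hL : pullForm L ((‖y‖ ^ 2)⁻¹ • flatForm E y) = (h z z).re • reciprocalForm h z) (v w : V) :
    inner ℂ (L v) (L w) * h z z ^ 2 = inner ℂ y y * potentialHessian h z z v w := by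
  have h_real : ((h z z).re : ℂ) = h z z := Complex.conj_eq_iff_re.1 (h_herm z z)
  have h_norm : ‖y‖ ≠ 0 := norm_ne_zero_iff.2 hy
  have h_clm : (h z z).re ^ 2 • (innerSL ℂ (L v)).comp L =
      ‖y‖ ^ 2 • potentialHessian h z z v := by
    refine clm_eq_of_forall_im_eq fun w => ?_
    have h_im : (‖y‖ ^ 2)⁻¹ * (inner ℂ (L v) (L w)).im = (h z z).re * reciprocalForm h z v w :=
      DFunLike.congr_fun (DFunLike.congr_fun hL v) w
    rw [reciprocalForm_apply h_herm hz, inv_mul_eq_iff_eq_mul₀ (pow_ne_zero 2 h_norm)] at h_im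
    simp only [smul_apply, ContinuousLinearMap.comp_apply, innerSL_apply_apply, Complex.smul_im,
      smul_eq_mul, h_im]
    field_simp
  have h_apply := DFunLike.congr_fun h_clm w
  rw [inner_self_eq_norm_sq_to_K, ← h_real]
  simpa [mul_comm] using h_apply

variable {U : Set V} {f : V → E}

lemma differentiableAt_fderiv_apply {p : V} (hf : ContDiffAt ℂ 2 f p) (v : V) :
    DifferentiableAt ℂ (fun p => fderiv ℂ f p v) p :=
  ((hf.fderiv_right (m := 1) le_rfl).differentiableAt one_ne_zero).clm_apply
    (differentiableAt_const v)

lemma inner_fderiv_mul_cube (hUo : IsOpen U) (hU : Convex ℝ U)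
    (h_herm : ∀ p q, conj (h p q) = h q p) (h_re : ∀ p ∈ U, (h p p).re ≠ 0)
    (hf : ContDiffOn ℂ 2 f U)
    (hf_iso : ∀ p ∈ U, pullForm (fderiv ℂ f p) (flatForm E (f p)) = reciprocalForm h p)
    {q p : V} (hq : q ∈ U) (hp : p ∈ U) (v w : V) :
    inner ℂ (fderiv ℂ f q v) (fderiv ℂ f p w) * h q p ^ 3 = potentialHessian h q p v w := by
  have hf' : ∀ v, ∀ p ∈ U, DifferentiableAt ℂ (fun p => fderiv ℂ f p v) p := fun v p hp =>
    differentiableAt_fderiv_apply (hf.contDiffAt (hUo.mem_nhds hp)) v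
  exact SesquiholomorphicOn.eq_of_diagonal
    ((sesquiholomorphicOn_inner (hf' v) (hf' w)).mul ((sesquiholomorphicOn_form h U).pow 3))
    (sesquiholomorphicOn_potentialHessian h v w U) hUo hU
    (fun p hp => inner_apply_mul_cube h_herm (h_re p hp) (hf_iso p hp) v w) hq hp

lemma inner_fderiv_mul_sq (hUo : IsOpen U) (hU : Convex ℝ U)
    (h_herm : ∀ p q, conj (h p q) = h q p) (h_re : ∀ p ∈ U, (h p p).re ≠ 0)
    (hf : ContDiffOn ℂ 2 f U) (hf0 : ∀ p ∈ U, f p ≠ 0)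
    (hf_conf : ∀ p ∈ U, pullForm (fderiv ℂ f p) ((‖f p‖ ^ 2)⁻¹ • flatForm E (f p)) =
      (h p p).re • reciprocalForm h p)
    {q p : V} (hq : q ∈ U) (hp : p ∈ U) (v w : V) :
    inner ℂ (fderiv ℂ f q v) (fderiv ℂ f p w) * h q p ^ 2 =
      inner ℂ (f q) (f p) * potentialHessian h q p v w := by
  have hf_at : ∀ p ∈ U, ContDiffAt ℂ 2 f p := fun p hp => hf.contDiffAt (hUo.mem_nhds hp)
  have hf_diff : ∀ p ∈ U, DifferentiableAt ℂ f p := fun p hp =>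
    (hf_at p hp).differentiableAt two_ne_zero
  have hf' : ∀ v, ∀ p ∈ U, DifferentiableAt ℂ (fun p => fderiv ℂ f p v) p := fun v p hp =>
    differentiableAt_fderiv_apply (hf_at p hp) v
  exact SesquiholomorphicOn.eq_of_diagonal
    ((sesquiholomorphicOn_inner (hf' v) (hf' w)).mul ((sesquiholomorphicOn_form h U).pow 2))
    ((sesquiholomorphicOn_inner hf_diff hf_diff).mul
      (sesquiholomorphicOn_potentialHessian h v w U)) hUo hU
    (fun p hp => inner_apply_mul_sq h_herm (h_re p hp) (hf0 p hp) (hf_conf p hp) v w) hq hp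

/-- Symmetry of second derivatives: `dk = M dφ` implies `dM ∧ dφ = 0`. -/
lemma fderiv_mul_comm_of_fderiv_eq_smul {k M φ : V → ℂ} {p : V} (hk : ContDiffAt ℂ 2 k p)
    (hφ : ContDiffAt ℂ 2 φ p) (hM : DifferentiableAt ℂ M p)
    (h_eq : fderiv ℂ k =ᶠ[𝓝 p] fun x => M x • fderiv ℂ φ x) (u w : V) :
    fderiv ℂ M p u * fderiv ℂ φ p w = fderiv ℂ M p w * fderiv ℂ φ p u := by
  have h_second : HasFDerivAt (fderiv ℂ k) _ p := (hM.hasFDerivAt.smul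
    ((hφ.fderiv_right (m := 1) le_rfl).differentiableAt
      one_ne_zero).hasFDerivAt).congr_of_eventuallyEq h_eq
  have hk_symm := hk.isSymmSndFDerivAt (by simp) u w
  have hφ_symm := hφ.isSymmSndFDerivAt (by simp) u w
  rw [h_second.fderiv] at hk_symm
  simp only [add_apply, smul_apply, ContinuousLinearMap.smulRight_apply, smul_eq_mul,
    hφ_symm] at hk_symm
  exact add_left_cancel hk_symm

section ConformalRigidity

variable (hUo : IsOpen U) (hU : Convex ℝ U) (h_herm : ∀ p q, conj (h p q) = h q p)
  (h_ne : ∀ q ∈ U, ∀ p ∈ U, h q p ≠ 0)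
  (hf : ContDiffOn ℂ 2 f U) (hf0 : ∀ p ∈ U, f p ≠ 0)
  (hf_conf : ∀ p ∈ U, pullForm (fderiv ℂ f p) ((‖f p‖ ^ 2)⁻¹ • flatForm E (f p)) =
    (h p p).re • reciprocalForm h p)
include hUo hf

lemma differentiableAt_inner_mul_form (q : V) {p : V} (hp : p ∈ U) :
    DifferentiableAt ℂ (fun p => inner ℂ (f q) (f p) * h q p) p :=
  ((innerSL ℂ (f q)).differentiableAt.comp p
    ((hf.contDiffAt (hUo.mem_nhds hp)).differentiableAt two_ne_zero)).mul
    (h q).differentiableAt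

include hU h_herm h_ne hf0 hf_conf

/-- By `inner_fderiv_mul_sq`, the function `k(p) = ⟨df_q v, f(p)⟩` satisfies `dk = M dφ` with
`M(p) = ⟨f(q), f(p)⟩ h(q, p)` and `φ(p) = - h(v, p) / h(q, p)²`. -/
lemma fderiv_inner_mul_form_comm {q p : V} (hq : q ∈ U) (hp : p ∈ U) (v u w : V) :
    fderiv ℂ (fun p => inner ℂ (f q) (f p) * h q p) p u * potentialHessian h q p v w =
      fderiv ℂ (fun p => inner ℂ (f q) (f p) * h q p) p w * potentialHessian h q p v u := by
  have hk : ContDiffAt ℂ 2 (fun x => innerSL ℂ (fderiv ℂ f q v) (f x)) p :=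
    (innerSL ℂ (fderiv ℂ f q v)).contDiff.contDiffAt.comp p (hf.contDiffAt (hUo.mem_nhds hp))
  have hφ : ContDiffAt ℂ 2 (fun x => -h v x / h q x ^ 2) p :=
    (h v).contDiff.neg.contDiffAt.div ((h q).contDiff.contDiffAt.pow 2)
      (pow_ne_zero 2 (h_ne q hq p hp))
  have h_re : ∀ p ∈ U, (h p p).re ≠ 0 := fun p hp =>
    re_form_self_ne_zero h_herm (h_ne p hp p hp)
  have h_eq : fderiv ℂ (fun x => innerSL ℂ (fderiv ℂ f q v) (f x)) =ᶠ[𝓝 p]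
      fun x => (inner ℂ (f q) (f x) * h q x) • fderiv ℂ (fun x => -h v x / h q x ^ 2) x := by
    filter_upwards [hUo.mem_nhds hp] with x hx
    have hk_x : HasFDerivAt (fun x => innerSL ℂ (fderiv ℂ f q v) (f x)) _ x :=
      (innerSL ℂ (fderiv ℂ f q v)).hasFDerivAt.comp x
        ((hf.contDiffAt (hUo.mem_nhds hx)).differentiableAt two_ne_zero).hasFDerivAt
    rw [hk_x.fderiv, (hasFDerivAt_neg_form_div_sq h v (h_ne q hq x hx)).fderiv]
    ext w
    have h_polar := inner_fderiv_mul_sq hUo hU h_herm h_re hf hf0 hf_conf hq hx v w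
    have h_qx := h_ne q hq x hx
    simp only [ContinuousLinearMap.comp_apply, smul_apply, smul_eq_mul, innerSL_apply_apply]
    field_simp
    exact h_polar
  have h_comm := fderiv_mul_comm_of_fderiv_eq_smul hk hφ
    (differentiableAt_inner_mul_form hUo hf q hp) h_eq u w
  rw [(hasFDerivAt_neg_form_div_sq h v (h_ne q hq p hp)).fderiv] at h_comm
  refine mul_left_cancel₀ (inv_ne_zero (pow_ne_zero 3 (h_ne q hq p hp))) ?_
  simp only [smul_apply, smul_eq_mul] at h_comm
  linear_combination h_comm

variable (h_orth : ∀ q ∈ U, ∃ c, h q c = 0 ∧ h c c ≠ 0)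
include h_orth

lemma fderiv_inner_mul_form_eq_zero {q p : V} (hq : q ∈ U) (hp : p ∈ U) :
    fderiv ℂ (fun p => inner ℂ (f q) (f p) * h q p) p = 0 := by
  obtain ⟨c, h_qc, h_cc⟩ := h_orth q hq
  have h_qp := h_ne q hq p hp
  have h_comm := fderiv_inner_mul_form_comm hUo hU h_herm h_ne hf hf0 hf_conf hq hp
  have h_zero_c : fderiv ℂ (fun p => inner ℂ (f q) (f p) * h q p) p c = 0 := by
    have h_qqp : potentialHessian h q p q p = h q p ^ 2 := by rw [potentialHessian_apply]; ring
    have h_qqc : potentialHessian h q p q c = 0 := by rw [potentialHessian_apply, h_qc]; ring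
    have := h_comm q c p
    rw [h_qqp, h_qqc, mul_zero] at this
    exact (mul_eq_zero.1 this).resolve_right (pow_ne_zero 2 h_qp)
  ext u
  have h_ccc : potentialHessian h q p c c = -(h q p * h c c) := by
    rw [potentialHessian_apply, h_qc]; ring
  have := h_comm c u c
  rw [h_zero_c, zero_mul, h_ccc] at this
  exact (mul_eq_zero.1 this).resolve_right (neg_ne_zero.2 (mul_ne_zero h_qp h_cc))

lemma inner_mul_form_eq {q p : V} (hq : q ∈ U) (hp : p ∈ U) :
    inner ℂ (f q) (f p) * h q p = inner ℂ (f q) (f q) * h q q := by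
  refine hU.is_const_of_fderivWithin_eq_zero (𝕜 := ℂ)
    (f := fun p => inner ℂ (f q) (f p) * h q p)
    (fun x hx => (differentiableAt_inner_mul_form hUo hf q hx).differentiableWithinAt)
    (fun x hx => ?_) hp hq
  rw [fderivWithin_of_isOpen hUo hx]
  exact fderiv_inner_mul_form_eq_zero hUo hU h_herm h_ne hf hf0 hf_conf h_orth hq hx

lemma norm_inner_sq_mul_norm_form_sq {q p : V} (hq : q ∈ U) (hp : p ∈ U) :
    ‖inner ℂ (f q) (f p)‖ ^ 2 * ‖h q p‖ ^ 2 =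
      ‖f q‖ ^ 2 * ‖f p‖ ^ 2 * (‖h q q‖ * ‖h p p‖) := by
  have h_rigid {q p : V} (hq : q ∈ U) (hp : p ∈ U) :=
    inner_mul_form_eq hUo hU h_herm h_ne hf hf0 hf_conf h_orth hq hp
  have h_norm_q : ‖inner ℂ (f q) (f p)‖ * ‖h q p‖ = ‖f q‖ ^ 2 * ‖h q q‖ := by
    simpa using congrArg norm (h_rigid hq hp)
  have h_norm_p : ‖inner ℂ (f q) (f p)‖ * ‖h q p‖ = ‖f p‖ ^ 2 * ‖h p p‖ := by
    have h_swap : ‖h p q‖ = ‖h q p‖ := by rw [← h_herm q p, Complex.norm_conj]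
    simpa [norm_inner_symm (f p), h_swap] using congrArg norm (h_rigid hp hq)
  rw [← mul_pow, sq]
  nth_rewrite 1 [h_norm_q]
  rw [h_norm_p]
  ring

end ConformalRigidity

end Isometry

section KahlerRigidity

variable {V : Type*} [NormedAddCommGroup V] [NormedSpace ℂ V] {h : V →L⋆[ℂ] V →L[ℂ] ℂ}
  {E : Type*} [NormedAddCommGroup E] [InnerProductSpace ℂ E] {U : Set V} {f : V → E}
  (hUo : IsOpen U) (hU : IsPreconnected U) (h_herm : ∀ p q, conj (h p q) = h q p)
  (h_ne : ∀ q ∈ U, ∀ p ∈ U, h q p ≠ 0) (hf : ContDiffOn ℂ ω f U)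
  (hf_iso : ∀ p ∈ U, pullForm (fderiv ℂ f p) (flatForm E (f p)) = reciprocalForm h p)
include hUo hU h_herm h_ne hf hf_iso

lemma inner_fderiv_mul_cube_of_isPreconnected {q p : V} (hq : q ∈ U) (hp : p ∈ U) (v w : V) :
    inner ℂ (fderiv ℂ f q v) (fderiv ℂ f p w) * h q p ^ 3 = potentialHessian h q p v w := by
  obtain ⟨ε, hε, h_ball⟩ := Metric.isOpen_iff.1 hUo q hq
  have h_near : (fun p => inner ℂ (fderiv ℂ f q v) (fderiv ℂ f p w) * h q p ^ 3) =ᶠ[𝓝 q]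
      fun p => potentialHessian h q p v w := by
    filter_upwards [Metric.ball_mem_nhds q hε] with x hx
    exact inner_fderiv_mul_cube Metric.isOpen_ball (convex_ball q ε) h_herm
      (fun p hp => re_form_self_ne_zero h_herm (h_ne p (h_ball hp) p (h_ball hp)))
      ((hf.mono h_ball).of_le le_top) (fun p hp => hf_iso p (h_ball hp))
      (Metric.mem_ball_self hε) hx v w
  have h_left : AnalyticOnNhd ℂ
      (fun p => inner ℂ (fderiv ℂ f q v) (fderiv ℂ f p w) * h q p ^ 3) U := fun p hp =>
    (((innerSL ℂ (fderiv ℂ f q v)).contDiff.contDiffAt.comp p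
      (((hf.contDiffAt (hUo.mem_nhds hp)).fderiv_right le_top).clm_apply contDiffAt_const)).mul
      ((h q).contDiff.contDiffAt.pow 3)).analyticAt
  have h_right : AnalyticOnNhd ℂ (fun p => potentialHessian h q p v w) U := fun p _ =>
    (((contDiff_const.mul (h v).contDiff).mul contDiff_const).sub
      ((h q).contDiff.mul contDiff_const)).contDiffAt.analyticAt
  exact h_left.eqOn_of_preconnected_of_eventuallyEq h_right hU hq h_near hp

lemma inner_fderiv_radial_mul_form {q p : V} (hq : q ∈ U) (hp : p ∈ U) :
    inner ℂ (fderiv ℂ f q q) (fderiv ℂ f p p) * h q p = 1 := by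
  have h_cube := inner_fderiv_mul_cube_of_isPreconnected hUo hU h_herm h_ne hf hf_iso hq hp q p
  rw [potentialHessian_apply] at h_cube
  refine mul_right_cancel₀ (pow_ne_zero 2 (h_ne q hq p hp)) ?_
  linear_combination h_cube

theorem smul_apply_eq_of_semiconj_smul (h_nondeg : ∀ x, (∀ q ∈ U, h q x = 0) → x = 0)
    {L : V →L[ℂ] V} (hL : Set.MapsTo L U U) {χ : ℂ} (h_equiv : ∀ z ∈ U, f (L z) = χ • f z)
    {p : V} (hp : p ∈ U) : χ • L p = p := by
  have hf_diff : ∀ p ∈ U, DifferentiableAt ℂ f p := fun p hp =>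
    (hf.contDiffAt (hUo.mem_nhds hp)).differentiableAt (by simp)
  have h_fderiv : (fderiv ℂ f (L p)).comp L = χ • fderiv ℂ f p := by
    refine HasFDerivAt.unique
      ((hf_diff _ (hL hp)).hasFDerivAt.comp p L.hasFDerivAt) ?_
    exact ((hf_diff p hp).hasFDerivAt.const_smul χ).congr_of_eventuallyEq
      (Filter.eventually_of_mem (hUo.mem_nhds hp) h_equiv)
  have h_radial : fderiv ℂ f (L p) (L p) = χ • fderiv ℂ f p p := DFunLike.congr_fun h_fderiv p
  refine sub_eq_zero.1 (h_nondeg _ fun q hq => ?_)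
  have h_p := inner_fderiv_radial_mul_form hUo hU h_herm h_ne hf hf_iso hq hp
  have h_Lp := inner_fderiv_radial_mul_form hUo hU h_herm h_ne hf hf_iso hq (hL hp)
  rw [h_radial, inner_smul_right] at h_Lp
  rw [map_sub, map_smul, smul_eq_mul]
  linear_combination h q p * h_Lp - χ * h q (L p) * h_p

end KahlerRigidity

section Domain

/-- The Hermitian form `h` on `ℂ²`, conjugate linear in the first variable, with
`h (z, z) = Im (x ȳ)` for `z = (x, y)`. -/
def herm : (Fin 2 → ℂ) →L⋆[ℂ] (Fin 2 → ℂ) →L[ℂ] ℂ :=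
  (2 * Complex.I)⁻¹ • ((innerSL ℂ).bilinearComp (.proj 1) (.proj 0) -
    (innerSL ℂ).bilinearComp (.proj 0) (.proj 1))

lemma herm_apply (q p : Fin 2 → ℂ) :
    herm q p = (2 * Complex.I)⁻¹ * (conj (q 1) * p 0 - conj (q 0) * p 1) := by
  simp [herm, mul_comm]

lemma conj_herm (p q : Fin 2 → ℂ) : conj (herm p q) = herm q p := by
  simp only [herm_apply, map_mul, map_sub, map_inv₀, Complex.conj_I, Complex.conj_conj,
    map_ofNat, mul_neg, inv_neg]
  ring

lemma herm_self (z : Fin 2 → ℂ) : herm z z = imProd z := by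
  rw [herm_apply, imProd, Complex.im_eq_sub_conj, map_mul, Complex.conj_conj]
  ring

lemma kahlerForm_eq_reciprocalForm : kahlerForm = reciprocalForm herm := by
  unfold kahlerForm reciprocalForm
  simp only [herm_self, Complex.ofReal_re]

lemma norm_herm_sq (q p : Fin 2 → ℂ) :
    ‖herm q p‖ ^ 2 = ‖p 0 * q 1 - p 1 * q 0‖ ^ 2 / 4 + imProd q * imProd p := by
  rw [herm_apply, norm_mul, mul_pow]
  simp only [norm_inv, norm_mul, Complex.norm_I, Complex.norm_ofNat, Complex.sq_norm,
    Complex.normSq_apply, imProd, Complex.sub_re, Complex.sub_im, Complex.mul_re, Complex.mul_im,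
    Complex.conj_re, Complex.conj_im]
  ring

lemma herm_ne_zero {q p : Fin 2 → ℂ} (hq : q ∈ D) (hp : p ∈ D) : herm q p ≠ 0 := by
  have hq_pos : 0 < imProd q := hq
  have hp_pos : 0 < imProd p := hp
  have h_pos : 0 < ‖herm q p‖ ^ 2 := by rw [norm_herm_sq]; positivity
  exact fun h => by simp [h] at h_pos

lemma exists_herm_eq_zero_and_self_ne_zero {q : Fin 2 → ℂ} (hq : q ∈ D) :
    ∃ c, herm q c = 0 ∧ herm c c ≠ 0 := by
  refine ⟨fun i => conj (q i), by rw [herm_apply]; ring, ?_⟩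
  have hq_ne : imProd q ≠ 0 := ne_of_gt hq
  have h_neg : imProd (fun i => conj (q i)) = -imProd q := by
    simp only [imProd, Complex.mul_im, Complex.conj_re, Complex.conj_im]
    ring
  rw [herm_self, h_neg]
  exact_mod_cast neg_ne_zero.2 hq_ne

lemma vec_mul_mem_D {w t : ℂ} (hw : 0 < w.im) (ht : t ≠ 0) : ![w * t, t] ∈ D := by
  have h_im : imProd ![w * t, t] = w.im * Complex.normSq t := by
    simp only [imProd, Matrix.cons_val_zero, Matrix.cons_val_one, mul_assoc, Complex.mul_conj,
      Complex.im_mul_ofReal]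
  change 0 < imProd _
  rw [h_im]
  exact mul_pos hw (Complex.normSq_pos.2 ht)

lemma vec_one_mem_D {w : ℂ} (hw : 0 < w.im) : ![w, 1] ∈ D := by
  simpa only [mul_one] using vec_mul_mem_D hw one_ne_zero

lemma eq_zero_of_forall_herm_eq_zero {x : Fin 2 → ℂ} (h : ∀ q ∈ D, herm q x = 0) : x = 0 := by
  have h_eq : ∀ w : ℂ, 0 < w.im → x 0 = conj w * x 1 := fun w hw => by
    simpa [herm_apply, sub_eq_zero] using h _ (vec_one_mem_D hw)
  have h_I := h_eq Complex.I (by simp)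
  have h_two_I := h_eq (2 * Complex.I) (by simp)
  simp only [map_mul, map_ofNat, Complex.conj_I] at h_I h_two_I
  have hx1 : x 1 = 0 := by
    have h_mul : x 1 * Complex.I = 0 := by linear_combination h_two_I - h_I
    exact (mul_eq_zero.1 h_mul).resolve_right Complex.I_ne_zero
  have hx0 : x 0 = 0 := by rw [h_I, hx1, mul_zero]
  exact funext (Fin.forall_fin_two.2 ⟨hx0, hx1⟩)

lemma apply_one_ne_zero {z : Fin 2 → ℂ} (hz : z ∈ D) : z 1 ≠ 0 := fun h => by
  have hz_pos : 0 < imProd z := hz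
  simp [imProd, h] at hz_pos

lemma im_div_pos {z : Fin 2 → ℂ} (hz : z ∈ D) : 0 < (z 0 / z 1).im := by
  have h_im : (z 0 / z 1).im = imProd z / Complex.normSq (z 1) := by
    rw [imProd, div_eq_mul_inv, Complex.inv_def, ← mul_assoc, Complex.im_mul_ofReal, div_eq_mul_inv]
  rw [h_im]
  exact div_pos hz (Complex.normSq_pos.2 (apply_one_ne_zero hz))

/-- `(w, t) ↦ (w t, t)` identifies the product of the upper half plane and `ℂ ∖ {0}` with `D`. -/
lemma isPreconnected_D : IsPreconnected (D : Set (Fin 2 → ℂ)) := by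
  have h_prod : IsPreconnected ({w : ℂ | 0 < w.im} ×ˢ ({0}ᶜ : Set ℂ)) :=
    (convex_halfSpace_im_gt 0).isPreconnected.prod
      (isConnected_compl_singleton_of_one_lt_rank (by simp) 0).isPreconnected
  have h_image : (D : Set (Fin 2 → ℂ)) =
      (fun a : ℂ × ℂ => ![a.1 * a.2, a.2]) '' ({w : ℂ | 0 < w.im} ×ˢ ({0}ᶜ : Set ℂ)) := by
    refine Set.Subset.antisymm (fun z hz => ?_) ?_
    · have hz1 := apply_one_ne_zero hz
      refine ⟨(z 0 / z 1, z 1), ⟨im_div_pos hz, hz1⟩, funext (Fin.forall_fin_two.2 ⟨?_, rfl⟩)⟩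
      exact div_mul_cancel₀ _ hz1
    · rintro _ ⟨⟨w, t⟩, ⟨hw, ht⟩, rfl⟩
      exact vec_mul_mem_D hw ht
  rw [h_image]
  exact h_prod.image _ (by fun_prop)

/-- If every line were fixed, then `Im (x / y)` would be a continuous unbounded function on the
compact quotient. -/
lemma exists_smul_not_collinear (Γ : Subgroup G) [CompactSpace (Surface Γ)] :
    ∃ (γ : Γ) (z : D), z.1 0 * (γ • z : D).1 1 ≠ z.1 1 * (γ • z : D).1 0 := by
  by_contra! h
  have h_inv : ∀ a b : D, (MulAction.orbitRel Γ D) a b →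
      (a.1 0 / a.1 1).im = (b.1 0 / b.1 1).im := by
    rintro _ z ⟨γ, rfl⟩
    have h_div : (γ • z : D).1 0 / (γ • z : D).1 1 = z.1 0 / z.1 1 := by
      rw [div_eq_div_iff (apply_one_ne_zero (γ • z).2) (apply_one_ne_zero z.2), mul_comm, ← h γ z]
    exact congrArg Complex.im h_div
  let height : Surface Γ → ℝ := Quotient.lift (fun z : D => (z.1 0 / z.1 1).im) h_inv
  have h_cont : Continuous height := by
    refine Continuous.quotient_lift ?_ _
    exact Complex.continuous_im.comp (((continuous_apply 0).comp continuous_subtype_val).div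
      ((continuous_apply 1).comp continuous_subtype_val) fun z => apply_one_ne_zero z.2)
  obtain ⟨b, hb⟩ := (isCompact_range h_cont).bddAbove
  have h_mem : ![((|b| + 1 : ℝ) : ℂ) * Complex.I, 1] ∈ D :=
    vec_one_mem_D (by rw [Complex.im_ofReal_mul, Complex.I_im]; positivity)
  have h_height : height (proj Γ D ⟨_, h_mem⟩) = |b| + 1 := by
    change (_ / _ : ℂ).im = _
    simp
  have h_le : height (proj Γ D ⟨_, h_mem⟩) ≤ b := hb ⟨_, rfl⟩
  linarith [le_abs_self b]

end Domain

section Pullback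

variable {V V' V'' : Type*} [NormedAddCommGroup V] [NormedSpace ℂ V]
  [NormedAddCommGroup V'] [NormedSpace ℂ V'] [NormedAddCommGroup V''] [NormedSpace ℂ V'']
  {M M' M'' : Type*} [TopologicalSpace M] [ChartedSpace V M] [TopologicalSpace M']
  [ChartedSpace V' M'] [TopologicalSpace M''] [ChartedSpace V'' M'']

lemma pullback_comp_apply {f : M → M'} {g : M' → M''} {x : M} (ζ : FormField V'' M'')
    (hg : MDifferentiableAt 𝓘(ℂ, V') 𝓘(ℂ, V'') g (f x))
    (hf : MDifferentiableAt 𝓘(ℂ, V) 𝓘(ℂ, V') f x) :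
    pullback (g ∘ f) ζ x =
      pullForm (differential f x : V →L[ℂ] V') (pullback g ζ (f x)) := by
  have h_comp : (differential (g ∘ f) x : V →L[ℂ] V'') =
      (differential g (f x) : V' →L[ℂ] V'').comp (differential f x) := mfderiv_comp x hg hf
  unfold pullback
  rw [h_comp]
  rfl

lemma IsHolomorphicIsometry.comp {η : FormField V M} {η' : FormField V' M'}
    {η'' : FormField V'' M''} {f : M → M'} {g : M' → M''} (hg : IsHolomorphicIsometry η' η'' g)
    (hf : IsHolomorphicIsometry η η' f) : IsHolomorphicIsometry η η'' (g ∘ f) where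
  holomorphic := hg.holomorphic.comp hf.holomorphic
  pullback_eq := by
    funext x
    rw [pullback_comp_apply _ ((hg.holomorphic _).mdifferentiableAt (by simp))
      ((hf.holomorphic _).mdifferentiableAt (by simp)), hg.pullback_eq, ← hf.pullback_eq]
    rfl

lemma pullback_apply_of_eventuallyEq_id {f : M → M} {x : M} (ζ : FormField V M)
    (h : f =ᶠ[𝓝 x] id) : pullback f ζ x = ζ x := by
  have h_id : differential f x = ContinuousLinearMap.id ℂ V := h.mfderiv_eq.trans mfderiv_id
  unfold pullback
  rw [h_id, h.self_of_nhds]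
  rfl

end Pullback

section OpenSubsets

variable {V V' : Type*} [NormedAddCommGroup V] [NormedSpace ℂ V]
  [NormedAddCommGroup V'] [NormedSpace ℂ V'] {Ω : Opens V}

lemma differential_subtype_val (x : Ω) :
    differential (fun y : Ω => (y : V)) x = ContinuousLinearMap.id ℂ V := by
  have h_chart : ∀ y ∈ Ω, (((chartAt V x).symm y : Ω) : V) = y := fun y hy => by
    have hy' : y ∈ (Ω.openPartialHomeomorphSubtypeCoe ⟨x⟩).target := by
      rwa [Opens.openPartialHomeomorphSubtypeCoe_target]
    exact (Ω.openPartialHomeomorphSubtypeCoe ⟨x⟩).right_inv hy'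
  refine HasMFDerivAt.mfderiv ⟨continuous_subtype_val.continuousAt, ?_⟩
  exact (hasFDerivWithinAt_id _ _).congr_of_eventuallyEq
    (nhdsWithin_le_nhds (Filter.eventually_of_mem (Ω.isOpen.mem_nhds x.2) h_chart))
    (h_chart x x.2)

lemma restrict_apply (η : FormField V V) (x : Ω) : restrict Ω η x = η x := by
  unfold restrict pullback
  rw [differential_subtype_val]
  rfl

lemma contMDiffAt_extend_subtype_val {φ : Ω → V'} {x : Ω}
    (hφ : ContMDiffAt 𝓘(ℂ, V) 𝓘(ℂ, V') (ω : WithTop ℕ∞) φ x) :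
    ContMDiffAt 𝓘(ℂ, V) 𝓘(ℂ, V') (ω : WithTop ℕ∞) (Function.extend Subtype.val φ 0) x.1 := by
  refine contMDiffAt_subtype_iff.1 (hφ.congr_of_eventuallyEq (.of_eq ?_))
  exact Function.extend_comp Subtype.val_injective φ 0

lemma pullForm_fderiv_extend_subtype_val {φ : Ω → V'} {x : Ω} (η : FormField V' V')
    (hφ : ContMDiffAt 𝓘(ℂ, V) 𝓘(ℂ, V') (ω : WithTop ℕ∞) φ x) :
    pullForm (fderiv ℂ (Function.extend Subtype.val φ 0) x.1) (η (φ x)) = pullback φ η x := by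
  have h_comp := pullback_comp_apply (f := fun y : Ω => (y : V)) η
    ((contMDiffAt_extend_subtype_val hφ).mdifferentiableAt (by simp))
    ((contMDiff_subtype_val x).mdifferentiableAt (n := ω) (by simp))
  have h_extend := Function.extend_comp Subtype.val_injective φ 0
  have h_apply : Function.extend Subtype.val φ 0 x.1 = φ x := congrFun h_extend x
  have h_fderiv : differential (Function.extend Subtype.val φ 0) x.1 =
      fderiv ℂ (Function.extend Subtype.val φ 0) x.1 := mfderiv_eq_fderiv
  have h_ext : (Function.extend Subtype.val φ 0 ∘ fun y : Ω => (y : V)) = φ := h_extend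
  rw [h_ext, differential_subtype_val] at h_comp
  rw [h_comp, pullback, h_fderiv, h_apply]
  rfl

end OpenSubsets

section Lift

variable {V V' : Type*} [NormedAddCommGroup V] [NormedSpace ℂ V]
  [NormedAddCommGroup V'] [NormedSpace ℂ V']
  {Γ : Type*} [Group Γ] {Ω : Opens V} [MulAction Γ Ω] [LinearCoveringAction Γ Ω]

lemma contMDiffAt_sheet_symm (p : OrbitSpace Γ Ω) {q : OrbitSpace Γ Ω}
    (hq : q ∈ (sheet p).target) :
    ContMDiffAt 𝓘(ℂ, V) 𝓘(ℂ, V) (ω : WithTop ℕ∞) (fun q => ((sheet p).symm q : V)) q := by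
  have hq' : q ∈ (quotChart p).source := by simpa [quotChart] using hq
  exact (contMDiffOn_chart (I := 𝓘(ℂ, V)) (n := ω) (x := p)).contMDiffAt
    ((quotChart p).open_source.mem_nhds hq')

lemma proj_sheet_symm (p : OrbitSpace Γ Ω) {q : OrbitSpace Γ Ω} (hq : q ∈ (sheet p).target) :
    proj Γ Ω ((sheet p).symm q) = q := by
  rw [← coe_sheet p]
  exact (sheet p).right_inv hq

lemma contMDiff_proj : ContMDiff 𝓘(ℂ, V) 𝓘(ℂ, V) (ω : WithTop ℕ∞) (proj Γ Ω) := by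
  intro x
  have hx := mem_chart_source V (proj Γ Ω x)
  obtain ⟨-, L, -, hL⟩ := quotChart_proj (proj Γ Ω x) hx
  have h_linear : ContMDiffAt 𝓘(ℂ, V) 𝓘(ℂ, V) ω (fun y : Ω => L (y : V)) x :=
    L.contDiff.contMDiff.contMDiffAt.comp x contMDiff_subtype_val.contMDiffAt
  have h_chart : ContMDiffAt 𝓘(ℂ, V) 𝓘(ℂ, V) ω
      (fun y => chartAt V (proj Γ Ω x) (proj Γ Ω y)) x := h_linear.congr_of_eventuallyEq hL
  have h_symm : ContMDiffAt 𝓘(ℂ, V) 𝓘(ℂ, V) ω (chartAt V (proj Γ Ω x)).symm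
      (chartAt V (proj Γ Ω x) (proj Γ Ω x)) :=
    (contMDiffOn_chart_symm (I := 𝓘(ℂ, V)) (n := ω) (x := proj Γ Ω x)).contMDiffAt
      ((chartAt V (proj Γ Ω x)).open_target.mem_nhds ((chartAt V (proj Γ Ω x)).map_source hx))
  refine (h_symm.comp x h_chart).congr_of_eventuallyEq ?_
  filter_upwards [(isQuotientCoveringMap_proj Γ Ω).continuous.continuousAt
    ((chartAt V (proj Γ Ω x)).open_source.mem_nhds hx)] with y hy
  exact ((chartAt V (proj Γ Ω x)).left_inv hy).symm

lemma isHolomorphicIsometry_proj {η : FormField V V} {ζ : FormField V (OrbitSpace Γ Ω)}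
    (hη : pullback (proj Γ Ω) ζ = restrict Ω η) :
    IsHolomorphicIsometry (restrict Ω η) ζ (proj Γ Ω) :=
  ⟨contMDiff_proj, hη⟩

lemma pullback_sheet_symm {η : FormField V V} {ζ : FormField V (OrbitSpace Γ Ω)}
    (hη : pullback (proj Γ Ω) ζ = restrict Ω η) (p : OrbitSpace Γ Ω) {q : OrbitSpace Γ Ω}
    (hq : q ∈ (sheet p).target) : pullback (fun q => ((sheet p).symm q : V)) η q = ζ q := by
  have h_symm : MDifferentiableAt 𝓘(ℂ, V) 𝓘(ℂ, V) (sheet p).symm q :=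
    ((ContMDiffAt.subtypeVal_comp_iff Ω (sheet p).symm q).1
      ((contMDiffAt_sheet_symm p hq).of_le le_top)).mdifferentiableAt (by simp)
  have h_id : proj Γ Ω ∘ (sheet p).symm =ᶠ[𝓝 q] id := by
    filter_upwards [(sheet p).open_target.mem_nhds hq] with y hy using proj_sheet_symm p hy
  calc pullback (fun q => ((sheet p).symm q : V)) η q
      = pullForm (differential (sheet p).symm q) (restrict Ω η ((sheet p).symm q)) :=
        pullback_comp_apply η ((contMDiff_subtype_val _).mdifferentiableAt (n := ω) (by simp))
          h_symm
    _ = pullback (proj Γ Ω ∘ (sheet p).symm) ζ q := by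
        rw [← hη, pullback_comp_apply ζ (mdifferentiable_proj _) h_symm]
    _ = ζ q := pullback_apply_of_eventuallyEq_id ζ h_id

lemma IsHolomorphicIsometry.exists_local_lift {Ω' : Opens V'} {η : FormField V V}
    {η' : FormField V' V'} {ζ : FormField V (OrbitSpace Γ Ω)}
    (hη : pullback (proj Γ Ω) ζ = restrict Ω η) {F : Ω' → OrbitSpace Γ Ω}
    (hF : IsHolomorphicIsometry (restrict Ω' η') ζ F) (x : Ω') :
    ∃ (U : Set V') (hU : U ⊆ Ω') (f : V' → V), IsOpen U ∧ Convex ℝ U ∧ (x : V') ∈ U ∧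
      ContDiffOn ℂ ω f U ∧ ∀ (z : V') (hz : z ∈ U),
        (∃ h : f z ∈ Ω, proj Γ Ω ⟨f z, h⟩ = F ⟨z, hU hz⟩) ∧
        pullForm (fderiv ℂ f z) (η (f z)) = η' z := by
  let φ : Ω' → V := fun z => ((sheet (F x)).symm (F z) : V)
  have h_preimage : IsOpen (Subtype.val '' (F ⁻¹' (sheet (F x)).target)) :=
    Ω'.isOpenEmbedding'.isOpenMap _ ((sheet (F x)).open_target.preimage hF.holomorphic.continuous)
  have hx_mem : F x ∈ (sheet (F x)).target := by
    simpa [chartAt_eq, quotChart] using mem_chart_source V (F x)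
  obtain ⟨ε, hε, h_ball⟩ := Metric.isOpen_iff.1 h_preimage x ⟨x, hx_mem, rfl⟩
  have h_target : ∀ z : Ω', (z : V') ∈ Metric.ball (x : V') ε → F z ∈ (sheet (F x)).target := by
    intro z hz
    obtain ⟨y, hy, h_eq⟩ := h_ball hz
    exact Subtype.ext h_eq ▸ hy
  have h_subset : Metric.ball (x : V') ε ⊆ Ω' := fun z hz => by
    obtain ⟨y, -, rfl⟩ := h_ball hz
    exact y.2
  have hφ : ∀ z : Ω', (z : V') ∈ Metric.ball (x : V') ε →
      ContMDiffAt 𝓘(ℂ, V') 𝓘(ℂ, V) ω φ z := fun z hz =>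
    (contMDiffAt_sheet_symm (F x) (h_target z hz)).comp z (hF.holomorphic z)
  refine ⟨Metric.ball x ε, h_subset, Function.extend Subtype.val φ 0, Metric.isOpen_ball,
    convex_ball _ _, Metric.mem_ball_self hε, fun z hz => ?_, fun z hz => ?_⟩
  · exact (contMDiffAt_extend_subtype_val
      (hφ ⟨z, h_subset hz⟩ hz)).contDiffAt.contDiffWithinAt
  · have h_apply : Function.extend Subtype.val φ 0 z = φ ⟨z, h_subset hz⟩ :=
      Subtype.val_injective.extend_apply φ 0 ⟨z, h_subset hz⟩
    simp only [h_apply]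
    refine ⟨⟨Subtype.coe_prop _, proj_sheet_symm (F x) (h_target ⟨z, h_subset hz⟩ hz)⟩, ?_⟩
    rw [pullForm_fderiv_extend_subtype_val η (hφ ⟨z, h_subset hz⟩ hz)]
    have h_comp := pullback_comp_apply η
      ((contMDiffAt_sheet_symm (F x) (h_target ⟨z, h_subset hz⟩ hz)).mdifferentiableAt (by simp))
      ((hF.holomorphic ⟨z, h_subset hz⟩).mdifferentiableAt (by simp))
    rw [pullback_sheet_symm hη (F x) (h_target ⟨z, h_subset hz⟩ hz)] at h_comp
    exact h_comp.trans ((congrFun hF.pullback_eq _).trans (restrict_apply η' _))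

end Lift

section HopfMaps

variable {E : Type*} [NormedAddCommGroup E] [InnerProductSpace ℂ E] {l : HopfFactor}

/-- The squared cosine of the angle between the complex lines through `x` and `y`. -/
def lineCosSq (x y : E) : ℝ := ‖inner ℂ x y‖ ^ 2 / (‖x‖ ^ 2 * ‖y‖ ^ 2)

lemma lineCosSq_smul_smul {c d : ℂ} (hc : c ≠ 0) (hd : d ≠ 0) (x y : E) :
    lineCosSq (c • x) (d • y) = lineCosSq x y := by
  have hc_norm : ‖c‖ ≠ 0 := norm_ne_zero_iff.2 hc
  have hd_norm : ‖d‖ ≠ 0 := norm_ne_zero_iff.2 hd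
  simp only [lineCosSq, inner_smul_left, inner_smul_right, norm_mul, Complex.norm_conj, norm_smul]
  rw [show (‖d‖ * (‖c‖ * ‖inner ℂ x y‖)) ^ 2 = (‖c‖ * ‖d‖) ^ 2 * ‖inner ℂ x y‖ ^ 2 by ring,
    show (‖c‖ * ‖x‖) ^ 2 * (‖d‖ * ‖y‖) ^ 2 = (‖c‖ * ‖d‖) ^ 2 * (‖x‖ ^ 2 * ‖y‖ ^ 2) by ring,
    mul_div_mul_left _ _ (pow_ne_zero 2 (mul_ne_zero hc_norm hd_norm))]

lemma lineCosSq_self {x : E} (hx : x ≠ 0) : lineCosSq x x = 1 := by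
  rw [lineCosSq, inner_self_eq_norm_sq_to_K, norm_pow, RCLike.norm_ofReal, abs_norm, ← sq,
    div_self (pow_ne_zero 2 (pow_ne_zero 2 (norm_ne_zero_iff.2 hx)))]

/-- The function induced by `lineCosSq` on pairs of points of a Hopf manifold, whose points lie on
well-defined complex lines. -/
def hopfCosSq : Hopf E l → Hopf E l → ℝ :=
  Quotient.lift₂ (fun x y : punctured E => lineCosSq (x : E) y) (by
    rintro _ _ x y ⟨g, rfl⟩ ⟨k, rfl⟩
    exact lineCosSq_smul_smul (g : ℂˣ).ne_zero (k : ℂˣ).ne_zero (x : E) y)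

lemma hopfCosSq_proj (x y : punctured E) :
    hopfCosSq (proj (Subgroup.zpowers l.val) _ x) (proj (Subgroup.zpowers l.val) _ y) =
      lineCosSq (x : E) y := rfl

lemma hopfCosSq_self (a : Hopf E l) : hopfCosSq a a = 1 := by
  rw [← proj_out a, hopfCosSq_proj]
  exact lineCosSq_self a.out.2

lemma contDiffAt_lineCosSq {V : Type*} [NormedAddCommGroup V] [NormedSpace ℂ V] {f : V → E}
    {z : V} (hf : ContDiffAt ℂ ω f z) (hf0 : f z ≠ 0) {x : E} (hx : x ≠ 0) :
    ContDiffAt ℝ ω (fun z => lineCosSq x (f z)) z := by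
  have hf_real : ContDiffAt ℝ ω f z := hf.restrict_scalars ℝ
  exact ((contDiffAt_const.inner ℂ hf_real).norm_sq ℝ).div
    (contDiffAt_const.mul (hf_real.norm_sq ℂ))
    (mul_ne_zero (pow_ne_zero 2 (norm_ne_zero_iff.2 hx)) (pow_ne_zero 2 (norm_ne_zero_iff.2 hf0)))

section Conformal

variable {V : Type*} [NormedAddCommGroup V] [NormedSpace ℂ V] {h : V →L⋆[ℂ] V →L[ℂ] ℂ}
  {Ω : Opens V} {F : Ω → Hopf E l}
  (h_herm : ∀ p q, conj (h p q) = h q p) (h_ne : ∀ q ∈ Ω, ∀ p ∈ Ω, h q p ≠ 0)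
  (hF : IsHolomorphicIsometry (restrict Ω fun z => (h z z).re • reciprocalForm h z)
    (hopfForm E l) F)
include hF

lemma analyticAt_extend_hopfCosSq (a : Hopf E l) (z : Ω) :
    AnalyticAt ℝ (Function.extend Subtype.val (fun z => hopfCosSq a (F z)) 0) (z : V) := by
  obtain ⟨U, hUΩ, f, hUo, -, hzU, hf, h_lift⟩ :=
    hF.exists_local_lift (pullback_hopfForm E l) z
  refine ((contDiffAt_lineCosSq (hf.contDiffAt (hUo.mem_nhds hzU)) (h_lift z hzU).1.1
    a.out.2).congr_of_eventuallyEq ?_).analyticAt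
  filter_upwards [hUo.mem_nhds hzU] with p hp
  obtain ⟨hp_ne, hp_proj⟩ := (h_lift p hp).1
  calc Function.extend Subtype.val (fun z => hopfCosSq a (F z)) 0 p
      = hopfCosSq a (F ⟨p, hUΩ hp⟩) := Subtype.val_injective.extend_apply _ _ (⟨p, hUΩ hp⟩ : Ω)
    _ = lineCosSq (a.out : E) (f p) := by
        rw [← hp_proj, ← hopfCosSq_proj a.out ⟨f p, hp_ne⟩, proj_out]

include h_herm h_ne

lemma hopfCosSq_mul_norm_form_sq_of_mem_nhds (h_orth : ∀ q ∈ Ω, ∃ c, h q c = 0 ∧ h c c ≠ 0)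
    (q : Ω) : ∀ᶠ p : V in 𝓝 q, ∀ hp : p ∈ Ω,
      hopfCosSq (F q) (F ⟨p, hp⟩) * ‖h q p‖ ^ 2 = ‖h q q‖ * ‖h p p‖ := by
  obtain ⟨U, hUΩ, f, hUo, hU_convex, hqU, hf, h_lift⟩ :=
    hF.exists_local_lift (pullback_hopfForm E l) q
  filter_upwards [hUo.mem_nhds hqU] with p hp _
  obtain ⟨hq_ne, hq_proj⟩ := (h_lift q hqU).1
  obtain ⟨hp_ne, hp_proj⟩ := (h_lift p hp).1
  have h_norm := norm_inner_sq_mul_norm_form_sq hUo hU_convex h_herm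
    (fun q hq p hp => h_ne q (hUΩ hq) p (hUΩ hp)) (hf.of_le le_top)
    (fun p hp => (h_lift p hp).1.1) (fun p hp => (h_lift p hp).2)
    (fun q hq => h_orth q (hUΩ hq)) hqU hp
  have hq_norm : ‖f q‖ ≠ 0 := norm_ne_zero_iff.2 hq_ne
  have hp_norm : ‖f p‖ ≠ 0 := norm_ne_zero_iff.2 hp_ne
  rw [← hq_proj, ← hp_proj, hopfCosSq_proj, lineCosSq, div_mul_eq_mul_div, h_norm,
    mul_div_cancel_left₀ _ (mul_ne_zero (pow_ne_zero 2 hq_norm) (pow_ne_zero 2 hp_norm))]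

theorem hopfCosSq_mul_norm_form_sq (hΩ : IsPreconnected (Ω : Set V))
    (h_orth : ∀ q ∈ Ω, ∃ c, h q c = 0 ∧ h c c ≠ 0) (q p : Ω) :
    hopfCosSq (F q) (F p) * ‖h q p‖ ^ 2 = ‖h q q‖ * ‖h p p‖ := by
  let cosSq : V → ℝ := Function.extend Subtype.val (fun z => hopfCosSq (F q) (F z)) 0
  have h_cosSq : ∀ z : Ω, cosSq z = hopfCosSq (F q) (F z) :=
    fun z => Subtype.val_injective.extend_apply _ _ z
  have h_left : AnalyticOnNhd ℝ (fun z => cosSq z * ‖h q z‖ ^ 2) Ω := fun z hz =>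
    (analyticAt_extend_hopfCosSq hF (F q) ⟨z, hz⟩).mul
      ((((h q).contDiff (n := ω)).restrict_scalars ℝ).norm_sq ℝ).contDiffAt.analyticAt
  have h_right : AnalyticOnNhd ℝ (fun z => ‖h q q‖ * ‖h z z‖) Ω := fun z hz => by
    have h_diag : ∀ z, ‖h z z‖ = ‖formRe h z z‖ := fun z => by
      rw [formRe_apply, ← Complex.norm_real, Complex.conj_eq_iff_re.1 (h_herm z z)]
    have h_re : formRe h z z ≠ 0 := re_form_self_ne_zero h_herm (h_ne z hz z hz)
    have h_contDiff : ContDiffAt ℝ ω (fun z => formRe h z z) z :=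
      ((formRe h).contDiff.clm_apply contDiff_id).contDiffAt
    simpa only [← h_diag] using
      (contDiffAt_const (c := ‖h q q‖).mul (h_contDiff.norm ℝ h_re)).analyticAt
  have h_near : (fun z => cosSq z * ‖h q z‖ ^ 2) =ᶠ[𝓝 (q : V)] fun z => ‖h q q‖ * ‖h z z‖ := by
    filter_upwards [hopfCosSq_mul_norm_form_sq_of_mem_nhds h_herm h_ne hF h_orth q,
      Ω.isOpen.mem_nhds q.2] with z h_eq hz
    rw [h_cosSq ⟨z, hz⟩, h_eq hz]
  have h_eqOn := h_left.eqOn_of_preconnected_of_eventuallyEq h_right hΩ q.2 h_near p.2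
  simpa only [h_cosSq] using h_eqOn

end Conformal

lemma mul_eq_mul_of_apply_eq {F : D → Hopf E l}
    (hF : IsHolomorphicIsometry (restrict D fun z => imProd z • kahlerForm z) (hopfForm E l) F)
    {p q : D} (hpq : F p = F q) : p.1 0 * q.1 1 = p.1 1 * q.1 0 := by
  have hF_herm : IsHolomorphicIsometry
      (restrict D fun z => (herm z z).re • reciprocalForm herm z) (hopfForm E l) F := by
    simpa only [herm_self, Complex.ofReal_re, ← kahlerForm_eq_reciprocalForm] using hF
  have h_cos := hopfCosSq_mul_norm_form_sq conj_herm (fun _ hq _ hp => herm_ne_zero hq hp) hF_herm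
    isPreconnected_D (fun _ hq => exists_herm_eq_zero_and_self_ne_zero hq) q p
  rw [hpq, hopfCosSq_self, one_mul, norm_herm_sq, herm_self, herm_self, Complex.norm_real,
    Complex.norm_real, Real.norm_of_nonneg (le_of_lt q.2), Real.norm_of_nonneg (le_of_lt p.2),
    add_eq_right] at h_cos
  have h_norm : ‖p.1 0 * q.1 1 - p.1 1 * q.1 0‖ ^ 2 = 0 := by linarith
  exact sub_eq_zero.1 (norm_eq_zero.1 (pow_eq_zero_iff two_ne_zero |>.1 h_norm))

theorem not_exists_isHolomorphicIsometry_hopf (Γ : Subgroup G) [DiscreteTopology Γ]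
    [ProperSMul Γ D] [IsCancelSMul Γ D] [CompactSpace (Surface Γ)] :
    ¬ ∃ f : Surface Γ → Hopf E l, IsHolomorphicIsometry (belgunForm Γ) (hopfForm E l) f := by
  rintro ⟨f, hf⟩
  obtain ⟨γ, z, h_lines⟩ := exists_smul_not_collinear Γ
  refine h_lines (mul_eq_mul_of_apply_eq
    (hf.comp (isHolomorphicIsometry_proj (pullback_belgunForm Γ))) ?_)
  exact congrArg f (proj_eq_iff.2 ⟨γ⁻¹, inv_smul_smul γ z⟩)

end HopfMaps

section Equivariance

variable {E : Type*} [NormedAddCommGroup E] [InnerProductSpace ℂ E] {ψ : D → E}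
  (hψ : IsHolomorphicIsometry (restrict D kahlerForm) (flatForm E) ψ)
include hψ

theorem smul_coe_eq_of_equivariant {g : G} {χ : ℂ} (h_equiv : ∀ z : D, ψ (g • z) = χ • ψ z)
    (z : D) : χ • ((g • z : D) : Fin 2 → ℂ) = z := by
  have h_ext : ∀ z : D, Function.extend Subtype.val ψ 0 z.1 = ψ z :=
    fun z => Subtype.val_injective.extend_apply ψ 0 z
  refine smul_apply_eq_of_semiconj_smul (f := Function.extend Subtype.val ψ 0)
    (L := (Matrix.mulVecLin g.1.val).toContinuousLinearMap) D.isOpen isPreconnected_D conj_herm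
    (fun _ hq _ hp => herm_ne_zero hq hp) (fun p hp => ?_) (fun p hp => ?_)
    (fun _ h => eq_zero_of_forall_herm_eq_zero h) (fun p hp => (g • (⟨p, hp⟩ : D)).2)
    (fun p hp => ?_) z.2
  · exact (contMDiffAt_extend_subtype_val
      (hψ.holomorphic ⟨p, hp⟩)).contDiffAt.contDiffWithinAt
  · rw [← kahlerForm_eq_reciprocalForm, h_ext ⟨p, hp⟩,
      pullForm_fderiv_extend_subtype_val (x := ⟨p, hp⟩) _ (hψ.holomorphic _), hψ.pullback_eq,
      restrict_apply]
  · exact (h_ext (g • ⟨p, hp⟩)).trans ((h_equiv ⟨p, hp⟩).trans (by rw [← h_ext]))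

theorem not_exists_forall_eq_smul (Γ : Subgroup G) [CompactSpace (Surface Γ)] :
    ¬ ∃ χ : Γ → ℂ, ∀ (γ : Γ) (z : D), ψ (γ • z) = χ γ • ψ z := by
  rintro ⟨χ, hχ⟩
  obtain ⟨γ, z, h_lines⟩ := exists_smul_not_collinear Γ
  have h_line : ∀ i, χ γ * (γ • z : D).1 i = z.1 i := fun i =>
    congrFun (smul_coe_eq_of_equivariant hψ (hχ γ) z) i
  refine h_lines ?_
  rw [← h_line 0, ← h_line 1]
  ring

theorem exists_apply_smul_ne {Γ : Subgroup G} [IsCancelSMul Γ D] {γ : Γ} (hγ : γ ≠ 1) :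
    ∃ z : D, ψ (γ • z) ≠ ψ z := by
  by_contra! h_inv
  have h_fix : ∀ z : D, γ • z = z := fun z => Subtype.ext <|
    (one_smul ℂ _).symm.trans (smul_coe_eq_of_equivariant hψ (g := γ) (χ := 1)
      (fun z => (h_inv z).trans (one_smul ℂ _).symm) z)
  let z : D := ⟨_, vec_one_mem_D (w := Complex.I) (by simp)⟩
  exact hγ (IsCancelSMul.right_cancel γ 1 z ((h_fix z).trans (one_smul Γ z).symm))

end Equivariance

end LcK

open LcK in
theorem mainTheorem9_general (E : Type*) [NormedAddCommGroup E] [InnerProductSpace ℂ E]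
    (Γ : Subgroup LcK.G) [DiscreteTopology Γ] [ProperSMul Γ LcK.D] [IsCancelSMul Γ LcK.D]
    [CompactSpace (LcK.Surface Γ)] :
    (∀ l : HopfFactor, ¬ ∃ f : Surface Γ → Hopf E l,
      IsHolomorphicIsometry (belgunForm Γ) (hopfForm E l) f) ∧
    (∀ ψ : D → E, IsHolomorphicIsometry (restrict D kahlerForm) (flatForm E) ψ →
      (¬ ∃ χ : Γ → ℂ, ∀ (γ : Γ) (z : D), ψ (γ • z) = χ γ • ψ z) ∧
      ∀ γ : Γ, γ ≠ 1 → ∃ z : D, ψ (γ • z) ≠ ψ z) :=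
  ⟨fun _ => not_exists_isHolomorphicIsometry_hopf Γ, fun _ hψ =>
    ⟨not_exists_forall_eq_smul hψ Γ, fun _ hγ => exists_apply_smul_ne hψ hγ⟩⟩

open LcK in
theorem mainTheorem9 (Γ : Subgroup LcK.G) [DiscreteTopology Γ] [ProperSMul Γ LcK.D]
    [IsCancelSMul Γ LcK.D] [CompactSpace (LcK.Surface Γ)] :
    (∀ (l : HopfFactor) (N : ℕ), ¬ ∃ f : Surface Γ → Hopf (EuclideanSpace ℂ (Fin N)) l,
      IsHolomorphicIsometry (belgunForm Γ) (hopfForm (EuclideanSpace ℂ (Fin N)) l) f) ∧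
    (∀ l : HopfFactor, ¬ ∃ f : Surface Γ → Hopf EllTwo l,
      IsHolomorphicIsometry (belgunForm Γ) (hopfForm EllTwo l) f) ∧
    (∀ ψ : D → EllTwo, IsHolomorphicIsometry (restrict D kahlerForm) (flatForm EllTwo) ψ →
      (¬ ∃ χ : Γ → ℂ, ∀ (γ : Γ) (z : D), ψ (γ • z) = χ γ • ψ z) ∧
      (∀ γ : Γ, γ ≠ 1 →
        (∃ c : ℂˣ, ((γ : G) : GL (Fin 2) ℂ) = Matrix.GeneralLinearGroup.scalar (Fin 2) c) →
        ∃ z : D, ψ (γ • z) ≠ ψ z)) :=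
  ⟨fun l N => (mainTheorem9_general (EuclideanSpace ℂ (Fin N)) Γ).1 l,
    (mainTheorem9_general EllTwo Γ).1, fun ψ hψ =>
      ((mainTheorem9_general EllTwo Γ).2 ψ hψ).imp_right fun h γ hγ _ => h γ hγ⟩
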